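/- Let $Q$ be a probability distribution on $\mathbb{R}$ with $\int x\,Q(dx)=0$, $\int x^2\,Q(dx)=1/2$ and $\int x^4\,Q(dx)<\infty$. Let $(X_{ii}/\sqrt2)_{i\in\mathbb{N}}$, $(X^{\mathrm{Re}}_{ij})_{i<j}$ and $(X^{\mathrm{Im}}_{ij})_{i<j}$ be independent families of independent real random variables with distribution $Q$ on some probability space. For $i<j$ put $X_{ij}:=X^{\mathrm{Re}}_{ij}+\mathbf{i}X^{\mathrm{Im}}_{ij}$ and $X_{ji}:=X^{\mathrm{Re}}_{ij}-\mathbf{i}X^{\mathrm{Im}}_{ij}$, and let $X_N:=(X_{ij})_{1\le i,j\le N}$ be the resulting Hermitian Wigner matrix. Let $\xi\in(-2,2)$, $\mu,\nu\in\mathbb{R}$, $\varrho(\xi):=\frac1{2\pi}\sqrt{4-\xi^2}$, and $$D_N(\xi,\eta):=\det\Big(X_N-\Big(\sqrt N\,\xi+\frac{\eta}{\sqrt N\varrho(\xi)}\Big)I_N\Big)\qquad(\eta\in\mathbb{R}),$$ where $I_N$ is the $N\times N$ identity matrix. Then $D_N(\xi,\mu)$ and $D_N(\xi,\nu)$ are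 square integrable for every $N$, their second moments are positive for all sufficiently large $N$, and $$\lim_{N\to\infty}\frac{\mathbb{E}\big(D_N(\xi,\mu)\,D_N(\xi,\nu)\big)}{\sqrt{\mathbb{E}D_N(\xi,\mu)^2}\,\sqrt{\mathbb{E}D_N(\xi,\nu)^2}}=\frac{\sin\pi(\mu-\nu)}{\pi(\mu-\nu)},$$ where $\sin 0/0:=1$. -/

import Mathlib

open MeasureTheory ProbabilityTheory Filter Topology

namespace Wigner

/-- The moment conditions on the entry distribution: mean `0`, variance `1/2`, finite fourth
moment (finiteness of the lower moments follows, as `Q` is a probability measure). -/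
structure MomentConditions (Q : Measure ℝ) : Prop where
  fourth : Integrable (fun x : ℝ => x ^ 4) Q
  mean : ∫ x, x ∂Q = 0
  variance : ∫ x, x ^ 2 ∂Q = 1 / 2

/-- The index set of the real random variables: the diagonal positions, and for each of the real
and imaginary parts the positions strictly above the diagonal. -/
abbrev EntryIndex : Type := ℕ ⊕ {p : ℕ × ℕ // p.1 < p.2} ⊕ {p : ℕ × ℕ // p.1 < p.2}

/-- The joint family consisting of `X i i / √2`, `Re (X i j)` and `Im (X i j)` for `i < j`.
The values of `Xre i j` and `Xim i j` for `j ≤ i` are never used. -/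
noncomputable def entries {Ω : Type*} (Xdiag : ℕ → Ω → ℝ) (Xre Xim : ℕ → ℕ → Ω → ℝ) :
    EntryIndex → Ω → ℝ :=
  Sum.elim (fun i ω => Xdiag i ω / √2)
    (Sum.elim (fun p => Xre p.1.1 p.1.2) (fun p => Xim p.1.1 p.1.2))

/-- `X i i / √2`, `Re (X i j)` and `Im (X i j)`, `i < j`, are independent random variables
with distribution `Q`. -/
structure IsWignerFamily {Ω : Type*} [MeasurableSpace Ω] (P : Measure Ω) (Q : Measure ℝ)
    (Xdiag : ℕ → Ω → ℝ) (Xre Xim : ℕ → ℕ → Ω → ℝ) : Prop where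
  measurable : ∀ k, Measurable (entries Xdiag Xre Xim k)
  law : ∀ k, P.map (entries Xdiag Xre Xim k) = Q
  indep : iIndepFun (entries Xdiag Xre Xim) P

/-- The Hermitian Wigner matrix `X_N`. -/
noncomputable def wignerMatrix {Ω : Type*} (Xdiag : ℕ → Ω → ℝ) (Xre Xim : ℕ → ℕ → Ω → ℝ)
    (N : ℕ) (ω : Ω) : Matrix (Fin N) (Fin N) ℂ :=
  Matrix.of fun i j =>
    if i < j then (Xre i j ω : ℂ) + Complex.I * (Xim i j ω : ℂ)
    else if j < i then (Xre j i ω : ℂ) - Complex.I * (Xim j i ω : ℂ)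
    else (Xdiag i ω : ℂ)

/-- The density of the semicircle law. -/
noncomputable def rho (ξ : ℝ) : ℝ := 1 / (2 * Real.pi) * √(4 - ξ ^ 2)

/-- The point `√N ξ + η / (√N ϱ(ξ))`. -/
noncomputable def point (N : ℕ) (ξ η : ℝ) : ℝ := √(N : ℝ) * ξ + η / (√(N : ℝ) * rho ξ)

/-- `D_N(ξ, η) = det (X_N - (√N ξ + η / (√N ϱ(ξ))) I_N)`. The determinant is that of a Hermitian
matrix, hence real; it equals its real part by `Wigner.coe_D`. -/
noncomputable def D {Ω : Type*} (Xdiag : ℕ → Ω → ℝ) (Xre Xim : ℕ → ℕ → Ω → ℝ)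
    (N : ℕ) (ξ η : ℝ) (ω : Ω) : ℝ :=
  (wignerMatrix Xdiag Xre Xim N ω
    - (point N ξ η : ℂ) • (1 : Matrix (Fin N) (Fin N) ℂ)).det.re

theorem isHermitian_wignerMatrix {Ω : Type*} (Xdiag : ℕ → Ω → ℝ) (Xre Xim : ℕ → ℕ → Ω → ℝ)
    (N : ℕ) (ω : Ω) : (wignerMatrix Xdiag Xre Xim N ω).IsHermitian := by
  ext i j
  rcases lt_trichotomy i j with h | h | h
  · simp [wignerMatrix, h, h.not_gt, sub_eq_add_neg]
  · subst h
    simp [wignerMatrix]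
  · simp [wignerMatrix, h, h.not_gt, sub_eq_add_neg]

theorem coe_D {Ω : Type*} (Xdiag : ℕ → Ω → ℝ) (Xre Xim : ℕ → ℕ → Ω → ℝ)
    (N : ℕ) (ξ η : ℝ) (ω : Ω) :
    (D Xdiag Xre Xim N ξ η ω : ℂ) =
      (wignerMatrix Xdiag Xre Xim N ω
        - (point N ξ η : ℂ) • (1 : Matrix (Fin N) (Fin N) ℂ)).det := by
  set A := wignerMatrix Xdiag Xre Xim N ω
    - (point N ξ η : ℂ) • (1 : Matrix (Fin N) (Fin N) ℂ) with hA
  have h : A.conjTranspose = A := by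
    rw [hA, Matrix.conjTranspose_sub, (isHermitian_wignerMatrix Xdiag Xre Xim N ω).eq]
    simp
  have h2 : star A.det = A.det := by rw [← Matrix.det_conjTranspose, h]
  exact Complex.conj_eq_iff_re.mp h2

end Wigner

/-! Write `p` for the characteristic polynomial of the `N × N` matrix, `He_n` for the probabilists'
Hermite polynomials, `K_M(z,w) = ∑_{n ≤ M} He_n(z) He_n(w) / n!` (`kern`) and `c = ∫ x⁴ dQ - 3/4`,
which is zero for Gaussian `Q`. The second moments have a closed form (`integral_charpoly_mul`): `E
p(z) p(w) = N! ∑_{2k ≤ N} c^k/k! K_{N-2k}(z,w)`.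

The formula is proved by induction on `N`. Expanding the determinant along the last row and column
and averaging over them (`integral_charpoly_succ`) leaves moments of `p` and `p'` and two sums over
the adjugates `A`, `B` of `z - M`, `w - M`, where `M` is the remaining submatrix. The sum of `A i j
* B j i` is a divided difference of `p` and `p'` by the resolvent identity. The sum of `A i i * B i
i`, with weight `2c`, consists of products of characteristic polynomials one size smaller still. To
keep `p'` and the smaller submatrices inside the induction, the claim is made for all pairs of
linear functionals of `p` and for all increasing index sets. The Hermite side satisfies the same
recursion (`momentForm_recursion`).

For the asymptotics no expansion of Hermite polynomials is needed. On the local scale, `He_n(x)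
exp(-x²/4)` solves `U'' = -q U` with `q → π²` uniformly on compact sets, so it is close to a
harmonic oscillation by Grönwall's inequality. By Christoffel-Darboux, `K_n` is essentially a
Wronskian divided by the distance, and on the diagonal an energy. For `U'' = -π² U` the quotient of
Wronskian and energy is `-sin(π(t-s))/π` whatever the phase and amplitude, so the normalised kernel
tends to the sine kernel (`tendsto_kern_ratio`). The top term of `K_n` is negligible, hence
`K_{N-2k}/K_N → 1`, and dominated convergence turns the sum over `k` into a factor `exp c`
(`tendsto_momentForm`), which the normalisation cancels. -/

namespace Wigner

/-! ### Determinants, adjugates and the resolvent identity -/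

section LinearAlgebra

open Polynomial Matrix

/-- Right multiplication by a block triangular matrix built from `M.adjugate` clears the block `B`
without inverting `M`. On taking determinants both sides carry the factor `M.det ^ card m`, which is
cancelled. -/
theorem det_fromBlocks_eq_sub_adjugate {R m : Type*} [CommRing R] [IsDomain R] [Fintype m]
    [DecidableEq m] (M : Matrix m m R) (B : Matrix m (Fin 1) R) (C : Matrix (Fin 1) m R)
    (D : Matrix (Fin 1) (Fin 1) R) (hM : M.det ≠ 0) :
    (fromBlocks M B C D).det = M.det * D 0 0 - (C * M.adjugate * B) 0 0 := by
  have h : fromBlocks M B C D * fromBlocks M.adjugate (-(M.adjugate * B)) 0 (M.det • 1)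
      = fromBlocks (M.det • 1) 0 (C * M.adjugate) (M.det • D - C * M.adjugate * B) := by
    rw [fromBlocks_multiply]
    congr 1
    · simp [mul_adjugate]
    · simp [← Matrix.mul_assoc, mul_adjugate]
    · simp
    · simp [Matrix.mul_assoc, sub_eq_add_neg, add_comm]
  have h2 := congrArg Matrix.det h
  rw [det_mul, det_fromBlocks_zero₂₁, det_fromBlocks_zero₁₂] at h2
  have h3 : M.adjugate.det * M.det = M.det ^ Fintype.card m := by
    rw [← det_mul, adjugate_mul]; simp
  simp only [det_smul, det_one, det_fin_one, mul_one, Fintype.card_fin, pow_one, Matrix.sub_apply,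
    Matrix.smul_apply, smul_eq_mul] at h2
  rw [h3] at h2
  exact mul_right_cancel₀ (pow_ne_zero _ hM) (h2.trans (mul_comm _ _))

theorem eval_charmatrix_adjugate {m : Type*} [Fintype m] [DecidableEq m]
    (M : Matrix m m ℂ) (z : ℂ) (i j : m) :
    eval z ((charmatrix M).adjugate i j) = (scalar m z - M).adjugate i j := by
  have h2 : (charmatrix M).adjugate.map (eval z) = (scalar m z - M).adjugate := by
    have := RingHom.map_adjugate (evalRingHom z) (charmatrix M)
    simp only [RingHom.mapMatrix_apply, coe_evalRingHom] at this
    rw [this]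
    congr 1
    ext1 i j
    by_cases h : i = j <;> simp [charmatrix, h]
  rw [← h2]; rfl

/-- The block formula is applied over `ℂ[X]`, where the determinant of the characteristic matrix is
monic and so nonzero, and evaluated afterwards. Thus eigenvalues `z` of the submatrix need no
exception. -/
theorem eval_charpoly_succ {n : ℕ} (A : Matrix (Fin (n + 1)) (Fin (n + 1)) ℂ) (z : ℂ) :
    A.charpoly.eval z =
      (z - A (Fin.last n) (Fin.last n)) *
          (A.submatrix Fin.castSucc Fin.castSucc).charpoly.eval z
        - ∑ i, ∑ j, A (Fin.last n) (Fin.castSucc i)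
            * (scalar (Fin n) z - A.submatrix Fin.castSucc Fin.castSucc).adjugate i j
            * A (Fin.castSucc j) (Fin.last n) := by
  set M := A.submatrix Fin.castSucc Fin.castSucc with hM
  have hdet : (charmatrix M).det ≠ 0 := (charpoly_monic M).ne_zero
  have h1 : A.charpoly = (fromBlocks (charmatrix M)
      (of fun i (_ : Fin 1) => -C (A (Fin.castSucc i) (Fin.last n)))
      (of fun (_ : Fin 1) i => -C (A (Fin.last n) (Fin.castSucc i)))
      (of fun (_ _ : Fin 1) => X - C (A (Fin.last n) (Fin.last n)))).det := by
    rw [charpoly]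
    refine (det_submatrix_equiv_self (finSumFinEquiv (m := n) (n := 1)) (charmatrix A)).symm.trans ?_
    congr 1
    ext1 i j
    rcases i with i | i <;> rcases j with j | j
    · by_cases h : i = j
      · subst h
        simp [charmatrix, hM]; rfl
      · have h' : Fin.castAdd 1 i ≠ Fin.castAdd 1 j := by simpa using h
        simp [charmatrix, hM, h, h']; rfl
    · have h' : Fin.castAdd 1 i ≠ Fin.natAdd n j := by
        intro h; have := congrArg Fin.val h; have := i.2; simp at *; omega
      simp [charmatrix, h']
      congr 2
      ext; simp
    · have h' : Fin.natAdd n i ≠ Fin.castAdd 1 j := by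
        intro h; have := congrArg Fin.val h; have := j.2; simp at *; omega
      simp [charmatrix, h']
      congr 2
      ext; simp
    · have h' : Fin.natAdd n i = Fin.last n := by ext; simp
      have h'' : Fin.natAdd n j = Fin.last n := by ext; simp
      simp [charmatrix, h', h'']
  rw [h1, det_fromBlocks_eq_sub_adjugate _ _ _ _ hdet, eval_sub, eval_mul]
  simp only [Matrix.mul_apply, of_apply, eval_finsetSum, eval_mul, eval_neg, eval_C, eval_charmatrix_adjugate,
    Finset.sum_mul, eval_sub, eval_X]
  rw [Finset.sum_comm]
  change M.charpoly.eval z * _ - _ = _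
  rw [mul_comm]
  congr 1
  refine Finset.sum_congr rfl fun i _ => Finset.sum_congr rfl fun j _ => by ring

/-- Jacobi's formula, term by term in the Leibniz expansion: entries of the characteristic matrix
have derivative `1` on the diagonal and `0` elsewhere, so differentiating factor `i` selects the
permutations fixing `i`. -/
theorem derivative_charpoly_eq_trace {m : Type*} [Fintype m] [DecidableEq m]
    (M : Matrix m m ℂ) : derivative M.charpoly = (charmatrix M).adjugate.trace := by
  have hadj : ∀ i, (charmatrix M).adjugate i i = ∑ σ : Equiv.Perm m,
      (Equiv.Perm.sign σ : ℤ) * ((∏ j ∈ Finset.univ.erase i, charmatrix M (σ j) j)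
        * (if σ i = i then 1 else 0)) := by
    intro i
    rw [← transpose_apply (charmatrix M).adjugate, adjugate_transpose, adjugate_apply,
      ← det_transpose, updateRow_transpose, transpose_transpose, det_apply']
    refine Finset.sum_congr rfl fun σ _ => ?_
    rw [← Finset.prod_erase_mul _ _ (Finset.mem_univ i)]
    congr 2
    · refine Finset.prod_congr rfl fun j hj => ?_
      rw [updateCol_ne (Finset.ne_of_mem_erase hj)]
    · simp [Pi.single_apply]
  have hder : ∀ σ : Equiv.Perm m, derivative (∏ i, charmatrix M (σ i) i)
      = ∑ i, (∏ j ∈ Finset.univ.erase i, charmatrix M (σ j) j) * (if σ i = i then 1 else 0) := by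
    intro σ
    rw [derivative_prod_finset]
    refine Finset.sum_congr rfl fun i _ => ?_
    congr 1
    by_cases h : σ i = i <;> simp [charmatrix, h]
  have htr : (charmatrix M).adjugate.trace = ∑ i, (charmatrix M).adjugate i i := rfl
  have hdet : M.charpoly = ∑ σ : Equiv.Perm m,
      ((Equiv.Perm.sign σ : ℤ) : ℂ[X]) * ∏ i, charmatrix M (σ i) i := det_apply' _
  rw [htr, hdet, derivative_sum, Finset.sum_congr rfl fun i _ => hadj i, Finset.sum_comm]
  refine Finset.sum_congr rfl fun σ _ => ?_
  rw [← Finset.mul_sum, derivative_intCast_mul, hder]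

theorem eval_derivative_charpoly {m : Type*} [Fintype m] [DecidableEq m]
    (M : Matrix m m ℂ) (z : ℂ) :
    eval z (derivative M.charpoly) = ∑ i, (scalar m z - M).adjugate i i := by
  simp [derivative_charpoly_eq_trace, trace, eval_finsetSum, eval_charmatrix_adjugate]

/-- The trace of the resolvent identity, multiplied by both determinants so that it holds at every
`z` and `w`. -/
theorem sub_mul_sum_adjugate_mul_adjugate {m : Type*} [Fintype m] [DecidableEq m]
    (M : Matrix m m ℂ) (z w : ℂ) :
    (z - w) * ∑ i, ∑ j, (scalar m z - M).adjugate i j * (scalar m w - M).adjugate j i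
      = eval z M.charpoly * eval w (derivative M.charpoly)
        - eval w M.charpoly * eval z (derivative M.charpoly) := by
  have h : (z - w) • ((scalar m z - M).adjugate * (scalar m w - M).adjugate)
      = (scalar m z - M).det • (scalar m w - M).adjugate
        - (scalar m w - M).det • (scalar m z - M).adjugate := by
    have e1 : (scalar m z - M).adjugate * ((scalar m z - M) - (scalar m w - M))
        * (scalar m w - M).adjugate = (z - w) • ((scalar m z - M).adjugate *
          (scalar m w - M).adjugate) := by
      have : (scalar m z - M) - (scalar m w - M) = (z - w) • (1 : Matrix m m ℂ) := by
        ext i j; by_cases h : i = j <;> simp [h]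
      rw [this]; simp
    rw [← e1, mul_sub, sub_mul, adjugate_mul, Matrix.mul_assoc, mul_adjugate]
    simp
  have h2 := congrArg trace h
  simp only [trace_sub, trace_smul, smul_eq_mul] at h2
  rw [eval_derivative_charpoly, eval_derivative_charpoly, eval_charpoly, eval_charpoly]
  simpa [trace, Matrix.mul_apply] using h2

end LinearAlgebra

/-! ### Hermite kernels and the algebraic recursion for the moments -/

section Hermite

open Polynomial

/-- The probabilists' Hermite polynomials over a commutative ring. -/
noncomputable def herm (𝕜 : Type*) [CommRing 𝕜] (n : ℕ) : 𝕜[X] :=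
  (hermite n).map (Int.castRingHom 𝕜)

/-- The values of the Hermite polynomials at a point. -/
noncomputable def hermEval {𝕜 : Type*} [CommRing 𝕜] (z : 𝕜) (n : ℕ) : 𝕜 := (herm 𝕜 n).eval z

/-- The values of the derivatives of the Hermite polynomials at a point. -/
noncomputable def hermDeriv {𝕜 : Type*} [CommRing 𝕜] (z : 𝕜) (n : ℕ) : 𝕜 :=
  (derivative (herm 𝕜 n)).eval z

section

variable {𝕜 : Type*} [CommRing 𝕜]

theorem herm_succ (n : ℕ) : herm 𝕜 (n + 1) = X * herm 𝕜 n - derivative (herm 𝕜 n) := by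
  simp [herm, hermite_succ, derivative_map]

theorem derivative_herm_succ (n : ℕ) :
    derivative (herm 𝕜 (n + 1)) = ((n : 𝕜[X]) + 1) * herm 𝕜 n := by
  induction n with
  | zero => simp [herm]
  | succ n ih =>
    rw [herm_succ (n + 1), derivative_sub, derivative_mul, ih, derivative_X, derivative_mul,
      herm_succ n]
    simp
    ring

theorem hermEval_zero (z : 𝕜) : hermEval z 0 = 1 := by simp [hermEval, herm]

theorem hermDeriv_zero (z : 𝕜) : hermDeriv z 0 = 0 := by simp [hermDeriv, herm]

theorem hermEval_succ (z : 𝕜) (n : ℕ) :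
    hermEval z (n + 1) = z * hermEval z n - hermDeriv z n := by
  simp [hermEval, hermDeriv, herm_succ n]

theorem hermDeriv_succ (z : 𝕜) (n : ℕ) :
    hermDeriv z (n + 1) = ((n : 𝕜) + 1) * hermEval z n := by
  simp [hermEval, hermDeriv, derivative_herm_succ n]

theorem natDegree_herm_le (n : ℕ) : (herm 𝕜 n).natDegree ≤ n := by
  simpa [herm] using (natDegree_map_le (f := Int.castRingHom 𝕜) (p := hermite n))

theorem hermEval_add_two (z : 𝕜) (n : ℕ) :
    hermEval z (n + 2) = z * hermEval z (n + 1) - ((n : 𝕜) + 1) * hermEval z n := by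
  rw [hermEval_succ z (n + 1), hermDeriv_succ]

end

open Nat in
/-- The sum `∑ a n * b n / n!` over `n ≤ M`. -/
noncomputable def kern {𝕜 : Type*} [Field 𝕜] (M : ℕ) (a b : ℕ → 𝕜) : 𝕜 :=
  ∑ n ∈ Finset.range (M + 1), a n * b n / (n ! : 𝕜)

theorem kern_succ {𝕜 : Type*} [Field 𝕜] (M : ℕ) (a b : ℕ → 𝕜) :
    kern (M + 1) a b = kern M a b + a (M + 1) * b (M + 1) / ((M + 1).factorial : 𝕜) := by
  rw [kern, Finset.sum_range_succ, ← kern]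

theorem kern_zero {𝕜 : Type*} [Field 𝕜] (a b : ℕ → 𝕜) : kern 0 a b = a 0 * b 0 := by simp [kern]

variable {𝕜 : Type*} [Field 𝕜] [CharZero 𝕜]

/-- The Christoffel-Darboux formula for Hermite polynomials. -/
theorem sub_mul_kern (z w : 𝕜) (M : ℕ) :
    (z - w) * kern M (hermEval z) (hermEval w) =
      (hermEval z (M + 1) * hermEval w M - hermEval z M * hermEval w (M + 1))
        / (M.factorial : 𝕜) := by
  induction M with
  | zero => simp [kern_zero, hermEval_succ, hermEval_zero, hermDeriv_zero]
  | succ M ih =>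
    have h : ((M.factorial : ℕ) : 𝕜) ≠ 0 := by exact_mod_cast M.factorial_ne_zero
    have h' : ((M : 𝕜) + 1) ≠ 0 := by exact_mod_cast M.succ_ne_zero
    rw [kern_succ, mul_add, ih, hermEval_add_two, hermEval_add_two, Nat.factorial_succ]
    push_cast
    field_simp
    ring

/-- Counterpart of the resolvent identity: the divided difference on the left is a polynomial kernel
again. The induction step is Christoffel-Darboux. -/
theorem kern_hermDeriv_sub (z w : 𝕜) (M : ℕ) :
    kern M (hermEval z) (hermDeriv w) - kern M (hermDeriv z) (hermEval w)
      = (z - w) * ∑ j ∈ Finset.range M, kern j (hermEval z) (hermEval w) := by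
  induction M with
  | zero => simp [kern_zero, hermDeriv_zero]
  | succ M ih =>
    have h : ((M.factorial : ℕ) : 𝕜) ≠ 0 := by exact_mod_cast M.factorial_ne_zero
    have h' : ((M : 𝕜) + 1) ≠ 0 := by exact_mod_cast M.succ_ne_zero
    rw [Finset.sum_range_succ, mul_add, ← ih, sub_mul_kern, kern_succ, kern_succ,
      hermDeriv_succ, hermDeriv_succ, Nat.factorial_succ]
    push_cast
    field_simp
    ring

/-- The border recursion with `c = 0`, divided by `M!`. The new top term of the right side is a
product of two factors `z * He - He'`, which accounts for the terms in `z * w`, `z`, `w` and the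
double derivative. -/
theorem kern_recursion (z w : 𝕜) (M : ℕ) :
    (1 + z * w) * kern M (hermEval z) (hermEval w) - z * kern M (hermEval z) (hermDeriv w)
      - w * kern M (hermDeriv z) (hermEval w) + kern M (hermDeriv z) (hermDeriv w)
      + ∑ j ∈ Finset.range M, kern j (hermEval z) (hermEval w)
      = ((M : 𝕜) + 1) * kern (M + 1) (hermEval z) (hermEval w) := by
  induction M with
  | zero =>
    simp [kern_succ, kern_zero, hermEval_succ, hermEval_zero, hermDeriv_zero]
  | succ M ih =>
    have h : ((M.factorial : ℕ) : 𝕜) ≠ 0 := by exact_mod_cast M.factorial_ne_zero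
    have h' : ((M : 𝕜) + 1) ≠ 0 := by exact_mod_cast M.succ_ne_zero
    have h'' : ((M : 𝕜) + 1 + 1) ≠ 0 := by exact_mod_cast (M + 1).succ_ne_zero
    have key : ((M + 1 : ℕ) + 1 : 𝕜) * (hermEval z (M + 2) * hermEval w (M + 2)
        / ((M + 2).factorial : 𝕜)) = (z * hermEval z (M + 1) - hermDeriv z (M + 1)) *
          (w * hermEval w (M + 1) - hermDeriv w (M + 1)) / ((M + 1).factorial : 𝕜) := by
      rw [← hermEval_succ, ← hermEval_succ, Nat.factorial_succ (M + 1)]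
      push_cast
      field_simp
    rw [kern_succ (M + 1), mul_add _ (kern (M + 1) _ _) _, key, kern_succ M (hermEval z)
      (hermDeriv w), kern_succ M (hermDeriv z), kern_succ M (hermDeriv z), Finset.sum_range_succ]
    have e := ih
    rw [kern_succ] at e ⊢
    push_cast
    linear_combination e

/-- The bilinear form describing the second moments of characteristic polynomials. -/
noncomputable def momentForm {𝕜 : Type*} [Field 𝕜] (c : 𝕜) (N : ℕ) (a b : ℕ → 𝕜) : 𝕜 :=
  (N.factorial : 𝕜) *
    ∑ k ∈ Finset.range (N / 2 + 1), c ^ k / (k.factorial : 𝕜) * kern (N - 2 * k) a b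

theorem momentForm_zero (c : 𝕜) (a b : ℕ → 𝕜) : momentForm c 0 a b = a 0 * b 0 := by
  simp [momentForm, kern_zero]

/-- In `(N + 1)! = N! (N + 1)` the factor is split as `(N + 1 - 2k) + 2k`. The first part gives the
sum on the left; the second cancels against `k!` and, after the shift `k → k + 1`, gives the term of
size `N - 1`. -/
theorem momentForm_weighted (c : 𝕜) (N : ℕ) (a b : ℕ → 𝕜) :
    (N.factorial : 𝕜) * ∑ k ∈ Finset.range (N / 2 + 1),
        c ^ k / (k.factorial : 𝕜) * (((N - 2 * k : ℕ) + 1 : 𝕜) * kern (N - 2 * k + 1) a b)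
      + 2 * c * N * momentForm c (N - 1) a b = momentForm c (N + 1) a b := by
  have hsub : ∀ k ∈ Finset.range (N / 2 + 1), N + 1 - 2 * k = N - 2 * k + 1 := by
    intro k hk; have := Finset.mem_range.1 hk; omega
  have h1 : ∑ k ∈ Finset.range ((N + 1) / 2 + 1), c ^ k / (k.factorial : 𝕜) *
        (((N + 1 - 2 * k : ℕ) : 𝕜) * kern (N + 1 - 2 * k) a b) =
      ∑ k ∈ Finset.range (N / 2 + 1),
        c ^ k / (k.factorial : 𝕜) * (((N - 2 * k : ℕ) + 1 : 𝕜) * kern (N - 2 * k + 1) a b) := by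
    symm
    refine (Finset.sum_congr rfl fun k hk => ?_).trans
      (Finset.sum_subset (Finset.range_mono (by omega)) fun k hk hk' => ?_)
    · rw [hsub k hk]; push_cast; rfl
    · have : N + 1 - 2 * k = 0 := by simp only [Finset.mem_range] at hk hk'; omega
      rw [this]; simp
  have h2 : 2 * c * N * momentForm c (N - 1) a b = (N.factorial : 𝕜) *
      ∑ k ∈ Finset.range ((N + 1) / 2 + 1), c ^ k / (k.factorial : 𝕜) *
        (((2 * k : ℕ) : 𝕜) * kern (N + 1 - 2 * k) a b) := by
    rcases N with _ | N
    · simp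
    · have e : (N + 1 + 1) / 2 = N / 2 + 1 := by omega
      rw [e, Finset.sum_range_succ', momentForm, Nat.factorial_succ]
      simp only [Nat.add_sub_cancel]
      push_cast
      simp only [mul_zero, zero_mul, add_zero]
      rw [Finset.mul_sum, Finset.mul_sum, Finset.mul_sum]
      refine Finset.sum_congr rfl fun k _ => ?_
      have h : ((k.factorial : ℕ) : 𝕜) ≠ 0 := by exact_mod_cast k.factorial_ne_zero
      have h' : ((k : 𝕜) + 1) ≠ 0 := by exact_mod_cast k.succ_ne_zero
      have e2 : N + 1 + 1 - 2 * (k + 1) = N - 2 * k := by omega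
      rw [e2, Nat.factorial_succ]
      push_cast
      field_simp
      ring
  rw [← h1, h2, ← mul_add, ← Finset.sum_add_distrib, momentForm, Nat.factorial_succ, mul_comm (N + 1),
    Nat.cast_mul, mul_assoc]
  congr 1
  rw [Finset.mul_sum]
  refine Finset.sum_congr rfl fun k hk => ?_
  have : (((N + 1 : ℕ)) : 𝕜) = ((N + 1 - 2 * k : ℕ) : 𝕜) + ((2 * k : ℕ) : 𝕜) := by
    rw [← Nat.cast_add]; congr 1; simp only [Finset.mem_range] at hk; omega
  rw [this]
  ring

/-- `T` stands for the expected trace of the product of the two adjugates. It is known only through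
the resolvent identity, which has to be divided by `z - w`. -/
theorem momentForm_recursion (c : 𝕜) {z w : 𝕜} (hzw : z ≠ w) (N : ℕ) {T : 𝕜}
    (hT : (z - w) * T = momentForm c N (hermEval z) (hermDeriv w)
      - momentForm c N (hermDeriv z) (hermEval w)) :
    (1 + z * w) * momentForm c N (hermEval z) (hermEval w)
      - z * momentForm c N (hermEval z) (hermDeriv w)
      - w * momentForm c N (hermDeriv z) (hermEval w)
      + momentForm c N (hermDeriv z) (hermDeriv w) + T
      + 2 * c * N * momentForm c (N - 1) (hermEval z) (hermEval w)
      = momentForm c (N + 1) (hermEval z) (hermEval w) := by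
  have hT' : T = (N.factorial : 𝕜) * ∑ k ∈ Finset.range (N / 2 + 1), c ^ k / (k.factorial : 𝕜) *
      ∑ j ∈ Finset.range (N - 2 * k), kern j (hermEval z) (hermEval w) := by
    apply mul_left_cancel₀ (sub_ne_zero.2 hzw)
    rw [hT, momentForm, momentForm, ← mul_sub, ← Finset.sum_sub_distrib, mul_left_comm,
      Finset.mul_sum (a := z - w)]
    congr 1
    refine Finset.sum_congr rfl fun k _ => ?_
    rw [← mul_sub, kern_hermDeriv_sub]; ring
  rw [← momentForm_weighted, hT']
  congr 1
  simp only [momentForm, Finset.mul_sum]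
  rw [← Finset.sum_sub_distrib, ← Finset.sum_sub_distrib, ← Finset.sum_add_distrib,
    ← Finset.sum_add_distrib]
  refine Finset.sum_congr rfl fun k _ => ?_
  rw [← kern_recursion, ← Finset.mul_sum, ← Finset.mul_sum]
  ring

end Hermite

/-! ### Comparison with the harmonic oscillator -/

section Oscillation

open Real Set

/-- Comparison of `U'' = -q U` with the harmonic oscillator when `q` is close to `π ^ 2`. -/
theorem abs_sub_harmonic_le {U V q : ℝ → ℝ} {s t ε : ℝ} (hst : s ≤ t) (hε : ε ≤ 1)
    (hU : ∀ x, HasDerivAt U (V x) x) (hV : ∀ x, HasDerivAt V (-(q x * U x)) x)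
    (hq : ∀ x ∈ Icc s t, |q x - π ^ 2| ≤ ε) :
    |U t - (U s * cos (π * (t - s)) + V s / π * sin (π * (t - s)))|
        ≤ ε * (|U s| + |V s|) * exp ((π ^ 2 + 1) * (t - s)) ∧
    |V t - (-(π * U s * sin (π * (t - s))) + V s * cos (π * (t - s)))|
        ≤ ε * (|U s| + |V s|) * exp ((π ^ 2 + 1) * (t - s)) := by
  have hε0 : 0 ≤ ε := (abs_nonneg _).trans (hq s ⟨le_rfl, hst⟩)
  have hπ : 1 ≤ π := by linarith [pi_gt_three]
  set p := U s
  set r := V s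
  have hlin : ∀ x, HasDerivAt (fun y => π * (y - s)) π x := fun x => by
    simpa using ((hasDerivAt_id x).sub_const s).const_mul π
  have hg1 : ∀ x, HasDerivAt (fun x => p * cos (π * (x - s)) + r / π * sin (π * (x - s)))
      (-(π * p * sin (π * (x - s))) + r * cos (π * (x - s))) x := fun x => by
    refine (((hlin x).cos.const_mul p).add ((hlin x).sin.const_mul (r / π))).congr_deriv ?_
    field_simp
  have hg2 : ∀ x, HasDerivAt (fun x => -(π * p * sin (π * (x - s))) + r * cos (π * (x - s)))
      (-(π ^ 2 * (p * cos (π * (x - s)) + r / π * sin (π * (x - s))))) x := fun x => by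
    refine (((hlin x).sin.const_mul (π * p)).neg.add
      ((hlin x).cos.const_mul r)).congr_deriv ?_
    field_simp
    ring
  -- In the sup norm `(u, v) ↦ (v, -q u)` has Lipschitz constant `max 1 |q|`, and `|q| ≤ π² + 1`
  -- because `ε ≤ 1`.
  set K : NNReal := ⟨π ^ 2 + 1, by positivity⟩ with hK
  have hK1 : (1 : ℝ) ≤ K := by
    change (1 : ℝ) ≤ π ^ 2 + 1; nlinarith
  have main := dist_le_of_approx_trajectories_ODE_of_mem (K := K) (a := s) (b := t)
    (v := fun x (z : ℝ × ℝ) => (z.2, -(q x * z.1))) (s := fun _ => univ)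
    (f := fun x => (U x, V x)) (f' := fun x => (V x, -(q x * U x)))
    (g := fun x => (p * cos (π * (x - s)) + r / π * sin (π * (x - s)),
      -(π * p * sin (π * (x - s))) + r * cos (π * (x - s))))
    (g' := fun x => (-(π * p * sin (π * (x - s))) + r * cos (π * (x - s)),
      -(π ^ 2 * (p * cos (π * (x - s)) + r / π * sin (π * (x - s))))))
    -- `(U, V)` is an exact trajectory. The harmonic one with the same initial data misses the
    -- equation by `|q - π²|` times its own size, which is at most `|p| + |r|`.
    (εf := 0) (εg := ε * (|p| + |r|)) (δ := 0)
    (by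
      intro x hx
      refine LipschitzOnWith.of_dist_le_mul fun y _ z _ => ?_
      have hqx : |q x| ≤ K := by
        have := hq x ⟨hx.1, hx.2.le⟩
        have h2 := abs_sub_abs_le_abs_sub (q x) (π ^ 2)
        rw [abs_of_nonneg (by positivity : (0 : ℝ) ≤ π ^ 2)] at h2
        change |q x| ≤ π ^ 2 + 1
        linarith
      rw [Prod.dist_eq]
      have hd : 0 ≤ dist y z := dist_nonneg
      refine max_le ?_ ?_
      · have h1 : dist y.2 z.2 ≤ dist y z := by rw [Prod.dist_eq]; exact le_max_right _ _
        simp only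
        nlinarith
      · have h1 : dist y.1 z.1 ≤ dist y z := by rw [Prod.dist_eq]; exact le_max_left _ _
        have h2 : dist (-(q x * y.1)) (-(q x * z.1)) = |q x| * dist y.1 z.1 := by
          rw [dist_neg_neg, Real.dist_eq, Real.dist_eq, ← mul_sub, abs_mul]
        simp only
        rw [h2]
        exact mul_le_mul hqx h1 dist_nonneg (by linarith))
    (fun x _ => ((hU x).continuousAt.prodMk (hV x).continuousAt).continuousWithinAt)
    (fun x _ => ((hU x).prodMk (hV x)).hasDerivWithinAt)
    (fun x _ => by simp) (fun _ _ => mem_univ _)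
    (fun x _ => ((hg1 x).continuousAt.prodMk (hg2 x).continuousAt).continuousWithinAt)
    (fun x _ => ((hg1 x).prodMk (hg2 x)).hasDerivWithinAt)
    (by
      intro x hx
      set y := p * cos (π * (x - s)) + r / π * sin (π * (x - s)) with hy
      have hyb : |y| ≤ |p| + |r| := by
        have h1 : |p * cos (π * (x - s))| ≤ |p| := by
          rw [abs_mul]; exact mul_le_of_le_one_right (abs_nonneg _) (abs_cos_le_one _)
        have h2 : |r / π * sin (π * (x - s))| ≤ |r| := by
          rw [abs_mul, abs_div, abs_of_pos pi_pos]
          calc |r| / π * |sin (π * (x - s))| ≤ |r| / π * 1 := by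
                gcongr; exact abs_sin_le_one _
            _ ≤ |r| := by rw [mul_one]; exact div_le_self (abs_nonneg _) hπ
        exact (abs_add_le _ _).trans (add_le_add h1 h2)
      rw [Prod.dist_eq]
      refine max_le (by simp; positivity) ?_
      simp only
      rw [Real.dist_eq, show -(π ^ 2 * y) - -(q x * y) = (q x - π ^ 2) * y by ring, abs_mul]
      exact mul_le_mul (hq x ⟨hx.1, hx.2.le⟩) hyb (abs_nonneg _) hε0)
    (fun _ _ => mem_univ _) (by simp [p, r]) t ⟨hst, le_rfl⟩
  have hbound : gronwallBound 0 K (0 + ε * (|p| + |r|)) (t - s)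
      ≤ ε * (|p| + |r|) * exp ((π ^ 2 + 1) * (t - s)) := by
    rw [gronwallBound_of_K_ne_0 (by linarith)]
    simp only [zero_mul, zero_add]
    have hnn : 0 ≤ ε * (|p| + |r|) := by positivity
    have h1 : (ε * (|p| + |r|)) / K ≤ ε * (|p| + |r|) := div_le_self hnn hK1
    have h2 : 0 ≤ exp (K * (t - s)) - 1 := by
      have : 1 ≤ exp (K * (t - s)) := one_le_exp (mul_nonneg (by linarith) (by linarith))
      linarith
    calc _ ≤ (ε * (|p| + |r|)) * (exp (K * (t - s)) - 1) := by gcongr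
      _ ≤ (ε * (|p| + |r|)) * exp (K * (t - s)) := by gcongr; linarith
  have main' := main.trans hbound
  rw [Prod.dist_eq] at main'
  exact ⟨(le_max_left _ _).trans main', (le_max_right _ _).trans main'⟩

/-- For an exact harmonic oscillation the Wronskian is `-sin(π(t-s))/π` times the energy, and the
energy is conserved. Both errors are bounded relative to the energy at `s`, so no knowledge of the
amplitude is required. -/
theorem wronskian_and_energy_le {U V q : ℝ → ℝ} {s t ε : ℝ} (hst : s ≤ t) (hε : ε ≤ 1)
    (hU : ∀ x, HasDerivAt U (V x) x) (hV : ∀ x, HasDerivAt V (-(q x * U x)) x)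
    (hq : ∀ x ∈ Icc s t, |q x - π ^ 2| ≤ ε) :
    |U s * V t - V s * U t + (V s ^ 2 + π ^ 2 * U s ^ 2) * (sin (π * (t - s)) / π)|
        ≤ 4 * (ε * exp ((π ^ 2 + 1) * (t - s))) * (V s ^ 2 + π ^ 2 * U s ^ 2) ∧
    |(V t ^ 2 + π ^ 2 * U t ^ 2) - (V s ^ 2 + π ^ 2 * U s ^ 2)|
        ≤ (1 + π ^ 2) * (8 * (ε * exp ((π ^ 2 + 1) * (t - s)))
          + 4 * (ε * exp ((π ^ 2 + 1) * (t - s))) ^ 2) * (V s ^ 2 + π ^ 2 * U s ^ 2) := by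
  have hε0 : 0 ≤ ε := (abs_nonneg _).trans (hq s ⟨le_rfl, hst⟩)
  have hπ : 1 ≤ π := by linarith [pi_gt_three]
  obtain ⟨h1, h2⟩ := abs_sub_harmonic_le hst hε hU hV hq
  set p := U s
  set r := V s
  set G := r ^ 2 + π ^ 2 * p ^ 2 with hG
  set η := ε * exp ((π ^ 2 + 1) * (t - s)) with hη
  have hη0 : 0 ≤ η := by positivity
  have hG0 : 0 ≤ G := by positivity
  have hsq : √G * √G = G := mul_self_sqrt hG0
  have hr : |r| ≤ √G := abs_le_sqrt (by rw [hG]; nlinarith [sq_nonneg (π * p)])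
  have hπp : π * |p| ≤ √G := by
    have h : |π * p| ≤ √G := abs_le_sqrt (by rw [hG]; nlinarith [sq_nonneg r])
    rwa [abs_mul, abs_of_pos pi_pos] at h
  have hp : |p| ≤ √G := le_trans (le_mul_of_one_le_left (abs_nonneg _) hπ) hπp
  have hsG : 0 ≤ √G := sqrt_nonneg _
  set c := cos (π * (t - s)) with hc
  set d := sin (π * (t - s)) with hd
  have hcd : d ^ 2 + c ^ 2 = 1 := sin_sq_add_cos_sq _
  have hc1 : |c| ≤ 1 := abs_cos_le_one _
  have hd1 : |d| ≤ 1 := abs_sin_le_one _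
  set g1 := p * c + r / π * d with hg1
  set g2 := -(π * p * d) + r * c with hg2
  have hδ : ε * (|p| + |r|) * exp ((π ^ 2 + 1) * (t - s)) ≤ 2 * η * √G := by
    have : |p| + |r| ≤ 2 * √G := by linarith
    calc _ = η * (|p| + |r|) := by rw [hη]; ring
      _ ≤ η * (2 * √G) := by gcongr
      _ = _ := by ring
  set δ1 := U t - g1 with hδ1
  set δ2 := V t - g2 with hδ2
  have hb1 : |δ1| ≤ 2 * η * √G := h1.trans hδ
  have hb2 : |δ2| ≤ 2 * η * √G := h2.trans hδ
  have hUt : U t = g1 + δ1 := by rw [hδ1]; ring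
  have hVt : V t = g2 + δ2 := by rw [hδ2]; ring
  have hmul : ∀ x y A B : ℝ, |x| ≤ A → |y| ≤ B → |x * y| ≤ A * B := fun x y A B hx hy => by
    rw [abs_mul]; exact mul_le_mul hx hy (abs_nonneg _) ((abs_nonneg _).trans hx)
  constructor
  · have e : U s * V t - V s * U t + G * (d / π) = p * δ2 - r * δ1 := by
      rw [hUt, hVt, hg1, hg2, hG]
      field_simp
      ring
    rw [e]
    have a1 := hmul _ _ _ _ hp hb2
    have a2 := hmul _ _ _ _ hr hb1
    calc |p * δ2 - r * δ1| ≤ |p * δ2| + |r * δ1| := abs_sub _ _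
      _ ≤ √G * (2 * η * √G) + √G * (2 * η * √G) := add_le_add a1 a2
      _ = 4 * η * (√G * √G) := by ring
      _ = _ := by rw [hsq]
  · have e0 : g2 ^ 2 + π ^ 2 * g1 ^ 2 = G := by
      have : g2 ^ 2 + π ^ 2 * g1 ^ 2 = G * (d ^ 2 + c ^ 2) := by
        rw [hg1, hg2, hG]; field_simp; ring
      rw [this, hcd, mul_one]
    have e : V t ^ 2 + π ^ 2 * U t ^ 2 - G
        = (2 * (g2 * δ2) + δ2 * δ2) + π ^ 2 * (2 * (g1 * δ1) + δ1 * δ1) := by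
      rw [hUt, hVt, ← e0]; ring
    have hg1b : |g1| ≤ 2 * √G := by
      have x1 := hmul p c _ 1 hp hc1
      have x2 : |r / π| ≤ √G := by
        rw [abs_div, abs_of_pos pi_pos]; exact (div_le_self (abs_nonneg _) hπ).trans hr
      have x3 := hmul _ d _ 1 x2 hd1
      exact (abs_add_le _ _).trans (by linarith)
    have hg2b : |g2| ≤ 2 * √G := by
      have x1 := hmul r c _ 1 hr hc1
      have x2 : |π * p| ≤ √G := by rw [abs_mul, abs_of_pos pi_pos]; exact hπp
      have x3 := hmul _ d _ 1 x2 hd1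
      rw [← abs_neg] at x3
      exact (abs_add_le _ _).trans (by linarith)
    have b : ∀ g δ : ℝ, |g| ≤ 2 * √G → |δ| ≤ 2 * η * √G →
        |2 * (g * δ) + δ * δ| ≤ (8 * η + 4 * η ^ 2) * G := by
      intro g δ hg hδ
      have x1 := hmul _ _ _ _ hg hδ
      have x2 := hmul _ _ _ _ hδ hδ
      calc |2 * (g * δ) + δ * δ| ≤ |2 * (g * δ)| + |δ * δ| := abs_add_le _ _
        _ = 2 * |g * δ| + |δ * δ| := by rw [abs_mul 2, abs_two]
        _ ≤ 2 * (2 * √G * (2 * η * √G)) + 2 * η * √G * (2 * η * √G) := by gcongr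
        _ = (8 * η + 4 * η ^ 2) * (√G * √G) := by ring
        _ = _ := by rw [hsq]
    rw [e]
    have y1 := b _ _ hg1b hb1
    have y2 := b _ _ hg2b hb2
    calc _ ≤ |2 * (g2 * δ2) + δ2 * δ2| + |π ^ 2 * (2 * (g1 * δ1) + δ1 * δ1)| := abs_add_le _ _
      _ = |2 * (g2 * δ2) + δ2 * δ2| + π ^ 2 * |2 * (g1 * δ1) + δ1 * δ1| := by
        rw [abs_mul (π ^ 2), abs_of_nonneg (by positivity : (0 : ℝ) ≤ π ^ 2)]
      _ ≤ (8 * η + 4 * η ^ 2) * G + π ^ 2 * ((8 * η + 4 * η ^ 2) * G) := by gcongr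
      _ = _ := by ring

end Oscillation

/-! ### From oscillation estimates to Hermite functions -/

section Asymptotics

open Real Set

/-- The shape of the quotient is dictated by `weighted_kern` and `weighted_kern_self`. Numerator and
denominator are both divided by the energy at `s`; the hypothesis `hpos` says that the trajectory is
not the zero solution. -/
theorem tendsto_oscillation_ratio {U V q : ℕ → ℝ → ℝ} {a ε : ℕ → ℝ} {s t : ℝ} (hst : s < t)
    (ha : Tendsto a atTop (𝓝 0)) (hε : Tendsto ε atTop (𝓝 0))
    (hU : ∀ n x, HasDerivAt (U n) (V n x) x)
    (hV : ∀ n x, HasDerivAt (V n) (-(q n x * U n x)) x)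
    (hq : ∀ᶠ n in atTop, ∀ x ∈ Icc s t, |q n x - π ^ 2| ≤ ε n)
    (hpos : ∀ n, 0 < (a n ^ 2 / 2 + q n s) * U n s ^ 2 + V n s ^ 2) :
    Tendsto (fun n => (a n ^ 2 / 2 * (U n s * U n t)
        + (U n s * V n t - V n s * U n t) / (s - t)) /
      √(((a n ^ 2 / 2 + q n s) * U n s ^ 2 + V n s ^ 2)
        * ((a n ^ 2 / 2 + q n t) * U n t ^ 2 + V n t ^ 2)))
      atTop (𝓝 (sinc (π * (s - t)))) := by
  have hπ : 1 ≤ π ^ 2 := one_le_pow₀ (by linarith [pi_gt_three])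
  set E : ℕ → ℝ → ℝ := fun n x => V n x ^ 2 + π ^ 2 * U n x ^ 2 with hE
  have hG : ∀ n, 0 < E n s := by
    intro n
    by_contra hc
    have h1 : V n s ^ 2 = 0 := by
      have := sq_nonneg (V n s); have := sq_nonneg (U n s); simp only [hE] at hc; nlinarith
    have h2 : U n s ^ 2 = 0 := by
      have := sq_nonneg (V n s); have := sq_nonneg (U n s); simp only [hE] at hc; nlinarith
    have := hpos n
    rw [h1, h2] at this
    simp at this
  have hE0 : ∀ n x, 0 ≤ E n x := fun n x => by positivity
  have hUE : ∀ n x, U n x ^ 2 ≤ E n x := fun n x => by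
    simp only [hE]; nlinarith [sq_nonneg (V n x), sq_nonneg (U n x)]
  have hε1 : ∀ᶠ n in atTop, ε n ≤ 1 := hε.eventually_le_const one_pos
  set C := exp ((π ^ 2 + 1) * (t - s)) with hC
  have hη : Tendsto (fun n => ε n * C) atTop (𝓝 0) := by simpa using hε.mul_const C
  have hEt : Tendsto (fun n => E n t / E n s) atTop (𝓝 1) := by
    rw [tendsto_iff_norm_sub_tendsto_zero]
    refine squeeze_zero' (g := fun n => (1 + π ^ 2) * (8 * (ε n * C) + 4 * (ε n * C) ^ 2))
      (Eventually.of_forall fun n => norm_nonneg _) ?_ ?_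
    · filter_upwards [hq, hε1] with n hqn hεn
      have := (wronskian_and_energy_le hst.le hεn (hU n) (hV n) hqn).2
      rw [Real.norm_eq_abs, div_sub_one (hG n).ne', abs_div, abs_of_pos (hG n),
        div_le_iff₀ (hG n)]
      exact this
    · have := ((hη.const_mul 8).add ((hη.pow 2).const_mul 4)).const_mul (1 + π ^ 2)
      simpa using this
  have hW : Tendsto (fun n => (U n s * V n t - V n s * U n t) / E n s) atTop
      (𝓝 (-(sin (π * (t - s)) / π))) := by
    rw [tendsto_iff_norm_sub_tendsto_zero]
    refine squeeze_zero' (g := fun n => 4 * (ε n * C))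
      (Eventually.of_forall fun n => norm_nonneg _) ?_ (by simpa using hη.const_mul 4)
    filter_upwards [hq, hε1] with n hqn hεn
    have := (wronskian_and_energy_le hst.le hεn (hU n) (hV n) hqn).1
    have e : (U n s * V n t - V n s * U n t) / E n s - -(sin (π * (t - s)) / π)
        = (U n s * V n t - V n s * U n t + E n s * (sin (π * (t - s)) / π)) / E n s := by
      have := (hG n).ne'
      field_simp
      ring
    rw [Real.norm_eq_abs, e, abs_div, abs_of_pos (hG n), div_le_iff₀ (hG n)]
    exact this
  have ha2 : Tendsto (fun n => a n ^ 2 / 2) atTop (𝓝 0) := by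
    simpa using (ha.pow 2).div_const 2
  -- The weight `a²/2 + q` differs from `π²` by at most `a²/2 + ε`, so the weighted expression
  -- agrees with the energy to leading order.
  have hD : ∀ x ∈ Icc s t, Tendsto (fun n => E n x / E n s) atTop (𝓝 1) →
      Tendsto (fun n => ((a n ^ 2 / 2 + q n x) * U n x ^ 2 + V n x ^ 2) / E n s) atTop
        (𝓝 1) := by
    intro x hx hEx
    have h0 : Tendsto (fun n => (a n ^ 2 / 2 + (q n x - π ^ 2)) * U n x ^ 2 / E n s) atTop
        (𝓝 0) := by
      refine squeeze_zero_norm' (a := fun n => (a n ^ 2 / 2 + ε n) * (E n x / E n s)) ?_ ?_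
      · filter_upwards [hq] with n hqn
        have h1 : |a n ^ 2 / 2 + (q n x - π ^ 2)| ≤ a n ^ 2 / 2 + ε n := by
          refine (abs_add_le _ _).trans (add_le_add ?_ (hqn x hx))
          rw [abs_of_nonneg (by positivity)]
        rw [Real.norm_eq_abs, mul_div_assoc, abs_mul, abs_div, abs_of_pos (hG n),
          abs_of_nonneg (sq_nonneg (U n x))]
        have h2 := hUE n x
        have h3 := (hG n).le
        have h4 : 0 ≤ a n ^ 2 / 2 + ε n := (abs_nonneg _).trans h1
        gcongr
      · simpa using (ha2.add hε).mul hEx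
    have := hEx.add h0
    rw [add_zero] at this
    refine this.congr fun n => ?_
    simp only [hE]
    ring
  have hD1 := hD s ⟨le_rfl, hst.le⟩ (by
    refine tendsto_const_nhds.congr fun n => ?_
    rw [div_self (hG n).ne'])
  have hD2 := hD t ⟨hst.le, le_rfl⟩ hEt
  have hX : Tendsto (fun n => a n ^ 2 / 2 * (U n s * U n t) / E n s) atTop (𝓝 0) := by
    refine squeeze_zero_norm (a := fun n => a n ^ 2 / 2 * (1 + E n t / E n s)) ?_ ?_
    · intro n
      have h1 : |U n s * U n t| ≤ E n s + E n t := by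
        have := hUE n s; have := hUE n t
        rw [abs_le]
        constructor <;> nlinarith [sq_nonneg (U n s - U n t), sq_nonneg (U n s + U n t)]
      have h3 := (hG n)
      rw [Real.norm_eq_abs, abs_div, abs_mul, abs_of_pos h3,
        abs_of_nonneg (by positivity : 0 ≤ a n ^ 2 / 2), mul_div_assoc]
      gcongr
      rw [div_le_iff₀ h3, add_mul, div_mul_cancel₀ _ h3.ne', one_mul]
      exact h1
    · simpa using ha2.mul (hEt.const_add 1)
  have hnum : Tendsto (fun n => (a n ^ 2 / 2 * (U n s * U n t)
        + (U n s * V n t - V n s * U n t) / (s - t)) / E n s) atTop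
      (𝓝 (sinc (π * (s - t)))) := by
    have := hX.add (hW.div_const (s - t))
    have hne : s - t ≠ 0 := by linarith
    have e : 0 + -(sin (π * (t - s)) / π) / (s - t) = sinc (π * (s - t)) := by
      rw [sinc_of_ne_zero (mul_ne_zero pi_ne_zero hne), zero_add,
        show π * (t - s) = -(π * (s - t)) by ring, sin_neg]
      field_simp
    rw [e] at this
    refine this.congr fun n => ?_
    have := (hG n).ne'
    field_simp
  have hden := (hD1.mul hD2).sqrt
  have := hnum.div hden (by simp)
  rw [one_mul, sqrt_one, div_one] at this
  refine this.congr fun n => ?_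
  have hGn := hG n
  simp only [Pi.div_apply]
  rw [div_mul_div_comm, sqrt_div' _ (by positivity), sqrt_mul_self hGn.le]
  field_simp

theorem hasDerivAt_hermEval (x : ℝ) (n : ℕ) :
    HasDerivAt (fun y : ℝ => hermEval y n) (hermDeriv x n) x :=
  (herm ℝ n).hasDerivAt x

theorem hasDerivAt_hermDeriv (x : ℝ) (n : ℕ) :
    HasDerivAt (fun y : ℝ => hermDeriv y n) (x * hermDeriv x n - n * hermEval x n) x := by
  rcases n with _ | n
  · simp only [hermDeriv_zero]
    simpa using hasDerivAt_const x (0 : ℝ)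
  · simp only [hermDeriv_succ]
    refine ((hasDerivAt_hermEval x n).const_mul ((n : ℝ) + 1)).congr_deriv ?_
    rw [hermEval_succ]
    push_cast
    ring

/-- The confluent form of Christoffel-Darboux; the bracket is `He_{n+1}(x)`. -/
theorem factorial_mul_kern_self {𝕜 : Type*} [Field 𝕜] [CharZero 𝕜] (x : 𝕜) (n : ℕ) :
    (n.factorial : 𝕜) * kern n (hermEval x) (hermEval x) =
      ((n : 𝕜) + 1) * hermEval x n ^ 2
        - (x * hermEval x n - hermDeriv x n) * hermDeriv x n := by
  induction n with
  | zero => simp [kern_zero, hermEval_zero, hermDeriv_zero]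
  | succ n ih =>
    have h : ((n.factorial : ℕ) : 𝕜) ≠ 0 := by exact_mod_cast n.factorial_ne_zero
    have h' : ((n : 𝕜) + 1) ≠ 0 := by exact_mod_cast n.succ_ne_zero
    rw [kern_succ, mul_add, mul_div_cancel₀ _ (by exact_mod_cast (n + 1).factorial_ne_zero),
      Nat.factorial_succ, Nat.cast_mul, mul_assoc, ih, hermDeriv_succ, hermEval_succ]
    push_cast
    ring

theorem kern_self_nonneg (M : ℕ) (a : ℕ → ℝ) : 0 ≤ kern M a a :=
  Finset.sum_nonneg fun _ _ => div_nonneg (mul_self_nonneg _) (Nat.cast_nonneg _)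

theorem kern_self_mono (a : ℕ → ℝ) : Monotone fun M => kern M a a :=
  monotone_nat_of_le_succ fun M => by
    rw [kern_succ]
    exact le_add_of_nonneg_right (div_nonneg (mul_self_nonneg _) (Nat.cast_nonneg _))

theorem kern_hermEval_self_pos (M : ℕ) (x : ℝ) : 0 < kern M (hermEval x) (hermEval x) := by
  refine lt_of_lt_of_le ?_ (kern_self_mono (hermEval x) (Nat.zero_le M))
  simp [kern_zero, hermEval_zero]

theorem abs_kern_le (M : ℕ) (a b : ℕ → ℝ) : |kern M a b| ≤ √(kern M a a * kern M b b) := by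
  apply abs_le_sqrt
  have h : ∀ c d : ℕ → ℝ, kern M c d = ∑ n ∈ Finset.range (M + 1),
      (c n / √(n.factorial : ℝ)) * (d n / √(n.factorial : ℝ)) := fun c d =>
    Finset.sum_congr rfl fun n _ => by
      rw [div_mul_div_comm, mul_self_sqrt (Nat.cast_nonneg _)]
  rw [h, h, h]
  simpa only [← sq] using Finset.sum_mul_sq_le_sq_mul_sq (Finset.range (M + 1))
    (fun n => a n / √(n.factorial : ℝ)) (fun n => b n / √(n.factorial : ℝ))

/-- The Hermite function `He_n(x) exp(-x ^ 2 / 4)` along the line `x = x₀ + a t`. -/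
noncomputable def hermFun (n : ℕ) (x₀ a t : ℝ) : ℝ :=
  hermEval (x₀ + a * t) n * exp (-(x₀ + a * t) ^ 2 / 4)

/-- The derivative of `hermFun` with respect to `t`. -/
noncomputable def hermFunDeriv (n : ℕ) (x₀ a t : ℝ) : ℝ :=
  a * ((hermDeriv (x₀ + a * t) n - (x₀ + a * t) / 2 * hermEval (x₀ + a * t) n)
    * exp (-(x₀ + a * t) ^ 2 / 4))

/-- The potential in the differential equation of `hermFun`. -/
noncomputable def hermPot (n : ℕ) (x₀ a t : ℝ) : ℝ :=
  a ^ 2 * (n + 1 / 2 - (x₀ + a * t) ^ 2 / 4)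

theorem hasDerivAt_line (x₀ a t : ℝ) : HasDerivAt (fun t => x₀ + a * t) a t := by
  simpa using ((hasDerivAt_id t).const_mul a).const_add x₀

theorem hasDerivAt_gauss_line (x₀ a t : ℝ) : HasDerivAt (fun t => exp (-(x₀ + a * t) ^ 2 / 4))
    (exp (-(x₀ + a * t) ^ 2 / 4) * (-(a * (x₀ + a * t) / 2))) t := by
  refine ((((hasDerivAt_line x₀ a t).pow 2).neg).div_const 4).exp.congr_deriv ?_
  simp
  ring

theorem hasDerivAt_hermFun (n : ℕ) (x₀ a t : ℝ) :
    HasDerivAt (hermFun n x₀ a) (hermFunDeriv n x₀ a t) t := by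
  refine (((hasDerivAt_hermEval _ n).comp t (hasDerivAt_line x₀ a t)).mul
    (hasDerivAt_gauss_line x₀ a t)).congr_deriv ?_
  simp only [hermFunDeriv, Function.comp_apply]
  ring

theorem hasDerivAt_hermFunDeriv (n : ℕ) (x₀ a t : ℝ) :
    HasDerivAt (hermFunDeriv n x₀ a) (-(hermPot n x₀ a t * hermFun n x₀ a t)) t := by
  refine (((((hasDerivAt_hermDeriv _ n).comp t (hasDerivAt_line x₀ a t)).sub
    (((hasDerivAt_line x₀ a t).div_const 2).mul
      ((hasDerivAt_hermEval _ n).comp t (hasDerivAt_line x₀ a t)))).mul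
    (hasDerivAt_gauss_line x₀ a t)).const_mul a).congr_deriv ?_
  simp only [hermPot, hermFun, Function.comp_apply, Pi.sub_apply, Pi.mul_apply]
  ring

/-- The summand `a²/2` turns the `n + 1/2` of the potential into the `n + 1` of the confluent
Christoffel-Darboux formula. -/
theorem weighted_kern_self (n : ℕ) (x₀ a t : ℝ) :
    (a ^ 2 / 2 + hermPot n x₀ a t) * hermFun n x₀ a t ^ 2 + hermFunDeriv n x₀ a t ^ 2
      = a ^ 2 * n.factorial * exp (-(x₀ + a * t) ^ 2 / 4) ^ 2
        * kern n (hermEval (x₀ + a * t)) (hermEval (x₀ + a * t)) := by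
  have h := factorial_mul_kern_self (x₀ + a * t) n
  calc _ = a ^ 2 * exp (-(x₀ + a * t) ^ 2 / 4) ^ 2 *
      (((n : ℝ) + 1) * hermEval (x₀ + a * t) n ^ 2
        - ((x₀ + a * t) * hermEval (x₀ + a * t) n - hermDeriv (x₀ + a * t) n)
          * hermDeriv (x₀ + a * t) n) := by
        simp only [hermPot, hermFun, hermFunDeriv]; ring
    _ = _ := by rw [← h]; ring

/-- Because of the Gaussian weight, the Wronskian contains only half of the term `(x - y) He_n(x)
He_n(y)` of Christoffel-Darboux. The summand with `a²/2` supplies the other half. -/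
theorem weighted_kern (n : ℕ) {x₀ a s t : ℝ} (ha : a ≠ 0) (hst : s ≠ t) :
    a ^ 2 / 2 * (hermFun n x₀ a s * hermFun n x₀ a t)
        + (hermFun n x₀ a s * hermFunDeriv n x₀ a t - hermFunDeriv n x₀ a s * hermFun n x₀ a t)
          / (s - t)
      = a ^ 2 * n.factorial * (exp (-(x₀ + a * s) ^ 2 / 4) * exp (-(x₀ + a * t) ^ 2 / 4))
        * kern n (hermEval (x₀ + a * s)) (hermEval (x₀ + a * t)) := by
  have h := sub_mul_kern (x₀ + a * s) (x₀ + a * t) n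
  rw [hermEval_succ, hermEval_succ, eq_div_iff (by exact_mod_cast n.factorial_ne_zero)] at h
  have hne : s - t ≠ 0 := sub_ne_zero.2 hst
  have hd : a * (s - t) ≠ 0 := mul_ne_zero ha hne
  have h2 : (x₀ + a * s) - (x₀ + a * t) = a * (s - t) := by ring
  rw [h2] at h
  apply mul_right_cancel₀ hne
  rw [add_mul, div_mul_cancel₀ _ hne]
  calc _ = a * (exp (-(x₀ + a * s) ^ 2 / 4) * exp (-(x₀ + a * t) ^ 2 / 4)) *
        (((x₀ + a * s) * hermEval (x₀ + a * s) n - hermDeriv (x₀ + a * s) n)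
          * hermEval (x₀ + a * t) n - hermEval (x₀ + a * s) n
          * ((x₀ + a * t) * hermEval (x₀ + a * t) n - hermDeriv (x₀ + a * t) n)) := by
        simp only [hermFun, hermFunDeriv]; ring
    _ = _ := by rw [← h]; ring

end Asymptotics

/-! ### The sine kernel limit in the bulk -/

section SineKernel

open Real Set

theorem rho_pos {ξ : ℝ} (hξ : ξ ∈ Ioo (-2 : ℝ) 2) : 0 < rho ξ := by
  have : 0 < 4 - ξ ^ 2 := by nlinarith [hξ.1, hξ.2]
  unfold rho
  positivity

/-- The left side is the limit of the potential at the scale `1/(√N ϱ(ξ))`: dividing by the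
semicircle density makes the limiting frequency `π` for every `ξ`. -/
theorem one_sub_sq_div_rho_sq {ξ : ℝ} (hξ : ξ ∈ Ioo (-2 : ℝ) 2) :
    (1 - ξ ^ 2 / 4) / rho ξ ^ 2 = π ^ 2 := by
  have h : 0 < 4 - ξ ^ 2 := by nlinarith [hξ.1, hξ.2]
  have h2 : rho ξ ^ 2 = 1 / (2 * π) ^ 2 * (4 - ξ ^ 2) := by
    rw [rho, mul_pow, sq_sqrt h.le, div_pow, one_pow]
  rw [div_eq_iff (pow_pos (rho_pos hξ) 2).ne', h2]
  field_simp
  ring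

theorem point_eq (N : ℕ) (ξ η : ℝ) : point N ξ η = √(N : ℝ) * ξ + 1 / (√(N : ℝ) * rho ξ) * η := by
  rw [point]; ring

/-- The degree `n + 1` may lag behind the matrix size `n + 1 + j` by a fixed `j`, as the kernels of
degree `N - 2k` require. The bound is uniform on compact sets in `t`. -/
theorem abs_hermPot_sub_le {ξ : ℝ} (hξ : ξ ∈ Ioo (-2 : ℝ) 2) (j : ℕ) (R : ℝ) :
    ∃ B : ℝ, ∀ n t, |t| ≤ R → |hermPot (n + 1) (√((n + 1 + j : ℕ) : ℝ) * ξ)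
      (1 / (√((n + 1 + j : ℕ) : ℝ) * rho ξ)) t - π ^ 2| ≤ B / ((n + 1 + j : ℕ) : ℝ) := by
  have hρ := rho_pos hξ
  set ρ := rho ξ with hρdef
  refine ⟨1 / ρ ^ 2 * (1 / 2 + j + |ξ| * R / (2 * ρ) + R ^ 2 / (4 * ρ ^ 2)), fun n t ht => ?_⟩
  have hN : (1 : ℝ) ≤ ((n + 1 + j : ℕ) : ℝ) := by
    exact_mod_cast (by omega : 1 ≤ n + 1 + j)
  have hNn : ((n + 1 : ℕ) : ℝ) = ((n + 1 + j : ℕ) : ℝ) - j := by push_cast; ring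
  set N : ℝ := ((n + 1 + j : ℕ) : ℝ) with hNdef
  have hN0 : 0 < N := by linarith
  have hs : √N ^ 2 = N := sq_sqrt hN0.le
  have hs0 : 0 < √N := sqrt_pos.2 hN0
  have e : hermPot (n + 1) (√N * ξ) (1 / (√N * ρ)) t - π ^ 2
      = 1 / ρ ^ 2 * (1 / 2 - j - ξ * t / (2 * ρ) - t ^ 2 / (4 * N * ρ ^ 2)) / N := by
    rw [← one_sub_sq_div_rho_sq hξ, ← hρdef, hermPot, hNn]
    have e1 : (1 / (√N * ρ)) ^ 2 = 1 / (N * ρ ^ 2) := by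
      rw [div_pow, mul_pow, hs, one_pow]
    have e2 : (√N * ξ + 1 / (√N * ρ) * t) ^ 2 = N * ξ ^ 2 + 2 * ξ * t / ρ
        + t ^ 2 / (N * ρ ^ 2) := by
      have : (√N * ξ + 1 / (√N * ρ) * t) ^ 2 = √N ^ 2 * ξ ^ 2 + 2 * ξ * t / ρ
        + (1 / (√N * ρ)) ^ 2 * t ^ 2 := by
        field_simp
        ring
      rw [this, e1, hs]
      ring
    rw [e1, e2]
    field_simp
    ring
  have hR : 0 ≤ R := (abs_nonneg t).trans ht
  have ht2 : t ^ 2 ≤ R ^ 2 := by rw [← sq_abs]; gcongr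
  rw [e, abs_div, abs_of_pos hN0, abs_mul, abs_of_pos (by positivity : 0 < 1 / ρ ^ 2)]
  gcongr
  have h1 : |ξ * t / (2 * ρ)| ≤ |ξ| * R / (2 * ρ) := by
    rw [abs_div, abs_mul, abs_of_pos (by positivity : 0 < 2 * ρ)]
    gcongr
  have h2 : |t ^ 2 / (4 * N * ρ ^ 2)| ≤ R ^ 2 / (4 * ρ ^ 2) := by
    rw [abs_of_nonneg (by positivity)]
    gcongr
    linarith
  have h3 : |(1 / 2 : ℝ) - j| ≤ 1 / 2 + j := by
    have : (0 : ℝ) ≤ j := Nat.cast_nonneg j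
    rw [abs_le]; constructor <;> linarith
  calc _ ≤ |(1 / 2 : ℝ) - j| + |ξ * t / (2 * ρ)| + |t ^ 2 / (4 * N * ρ ^ 2)| :=
        (abs_sub _ _).trans (by gcongr; exact abs_sub _ _)
    _ ≤ _ := by gcongr

theorem tendsto_const_div_nat (B : ℝ) (j : ℕ) :
    Tendsto (fun n : ℕ => B / ((n + 1 + j : ℕ) : ℝ)) atTop (𝓝 0) := by
  have := (tendsto_add_atTop_iff_nat (1 + j)).2 (tendsto_const_div_atTop_nhds_zero_nat B)
  simpa [add_assoc] using this

theorem tendsto_scale (r : ℝ) (j : ℕ) :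
    Tendsto (fun n : ℕ => 1 / (√((n + 1 + j : ℕ) : ℝ) * r)) atTop (𝓝 0) := by
  have h := (tendsto_const_div_nat 1 j).sqrt
  rw [sqrt_zero] at h
  have := h.mul_const (1 / r)
  rw [zero_mul] at this
  refine this.congr fun n => ?_
  rw [sqrt_div' _ (Nat.cast_nonneg _), sqrt_one, div_mul_div_comm, one_mul]

theorem kern_comm {𝕜 : Type*} [Field 𝕜] (M : ℕ) (a b : ℕ → 𝕜) : kern M a b = kern M b a :=
  Finset.sum_congr rfl fun n _ => by rw [mul_comm (a n)]

/-- The sine kernel asymptotics of the Hermite kernel in the bulk. -/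
theorem tendsto_kern_ratio {ξ : ℝ} (hξ : ξ ∈ Ioo (-2 : ℝ) 2) (s t : ℝ) (j : ℕ) :
    Tendsto (fun n : ℕ => kern n (hermEval (point (n + j) ξ s)) (hermEval (point (n + j) ξ t)) /
      √(kern n (hermEval (point (n + j) ξ s)) (hermEval (point (n + j) ξ s))
        * kern n (hermEval (point (n + j) ξ t)) (hermEval (point (n + j) ξ t))))
      atTop (𝓝 (sinc (π * (s - t)))) := by
  wlog hst : s < t generalizing s t
  · rcases (not_lt.1 hst).eq_or_lt with h | h
    · subst h
      rw [sub_self, mul_zero, sinc_zero]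
      refine tendsto_const_nhds.congr fun n => ?_
      have := kern_hermEval_self_pos n (point (n + j) ξ t)
      rw [sqrt_mul_self this.le, div_self this.ne']
    · have := this t s h
      rw [show π * (s - t) = -(π * (t - s)) by ring, sinc_neg]
      refine this.congr fun n => ?_
      rw [kern_comm, mul_comm (kern n _ _)]
  -- The shift keeps the matrix size `n + 1 + j` positive, so the scale `1/(√N ϱ)` is never a
  -- division by zero.
  rw [← tendsto_add_atTop_iff_nat 1]
  have hρ := rho_pos hξ
  obtain ⟨B, hB⟩ := abs_hermPot_sub_le hξ j (max |s| |t|)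
  have hN : ∀ n : ℕ, 0 < √((n + 1 + j : ℕ) : ℝ) := fun n => sqrt_pos.2 (by positivity)
  have ha0 : ∀ n : ℕ, 0 < 1 / (√((n + 1 + j : ℕ) : ℝ) * rho ξ) := fun n => by
    have := hN n; positivity
  have := tendsto_oscillation_ratio
    (U := fun n => hermFun (n + 1) (√((n + 1 + j : ℕ) : ℝ) * ξ)
      (1 / (√((n + 1 + j : ℕ) : ℝ) * rho ξ)))
    (V := fun n => hermFunDeriv (n + 1) (√((n + 1 + j : ℕ) : ℝ) * ξ)
      (1 / (√((n + 1 + j : ℕ) : ℝ) * rho ξ)))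
    (q := fun n => hermPot (n + 1) (√((n + 1 + j : ℕ) : ℝ) * ξ)
      (1 / (√((n + 1 + j : ℕ) : ℝ) * rho ξ))) hst
    (tendsto_scale (rho ξ) j) (tendsto_const_div_nat B j)
    (fun n x => hasDerivAt_hermFun _ _ _ _) (fun n x => hasDerivAt_hermFunDeriv _ _ _ _)
    (Eventually.of_forall fun n x hx => hB n x (abs_le_max_abs_abs hx.1 hx.2))
    (fun n => by
      rw [weighted_kern_self]
      have h1 := kern_hermEval_self_pos (n + 1) (√((n + 1 + j : ℕ) : ℝ) * ξ
        + 1 / (√((n + 1 + j : ℕ) : ℝ) * rho ξ) * s)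
      have h2 := ha0 n
      positivity)
  refine this.congr fun n => ?_
  rw [weighted_kern_self, weighted_kern_self, weighted_kern _ (ha0 n).ne' hst.ne,
    ← point_eq, ← point_eq]
  set x := point (n + 1 + j) ξ s
  set y := point (n + 1 + j) ξ t
  have hx := kern_hermEval_self_pos (n + 1) x
  have hy := kern_hermEval_self_pos (n + 1) y
  set b := (1 / (√((n + 1 + j : ℕ) : ℝ) * rho ξ)) ^ 2 * ((n + 1).factorial : ℝ) with hb
  have hb0 : 0 < b := by have := ha0 n; positivity
  set ex := exp (-x ^ 2 / 4)
  set ey := exp (-y ^ 2 / 4)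
  have hex : 0 < ex := exp_pos _
  have hey : 0 < ey := exp_pos _
  -- The Gaussian factors and the prefactor `b` enter numerator and denominator to the same power
  -- and cancel.
  have e : b * ex ^ 2 * kern (n + 1) (hermEval x) (hermEval x)
      * (b * ey ^ 2 * kern (n + 1) (hermEval y) (hermEval y))
      = (b * (ex * ey)) ^ 2 * (kern (n + 1) (hermEval x) (hermEval x)
        * kern (n + 1) (hermEval y) (hermEval y)) := by ring
  rw [e, sqrt_mul (by positivity), sqrt_sq (by positivity), mul_div_mul_left _ _ (by positivity)]

/-- Once the potential is at least `1`, the square of the Hermite function is bounded by the left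
side of `weighted_kern_self`. So the top term takes at most the fraction `a²` of the kernel, and the
scale `a` tends to `0`. -/
theorem tendsto_herm_sq_div_kern {ξ : ℝ} (hξ : ξ ∈ Ioo (-2 : ℝ) 2) (t : ℝ) (j : ℕ) :
    Tendsto (fun n : ℕ => hermEval (point (n + j) ξ t) n * hermEval (point (n + j) ξ t) n
      / (n.factorial : ℝ) / kern n (hermEval (point (n + j) ξ t)) (hermEval (point (n + j) ξ t)))
      atTop (𝓝 0) := by
  rw [← tendsto_add_atTop_iff_nat 1]
  have hρ := rho_pos hξ
  obtain ⟨B, hB⟩ := abs_hermPot_sub_le hξ j |t|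
  have h1 : ∀ᶠ n : ℕ in atTop, B / ((n + 1 + j : ℕ) : ℝ) ≤ 1 :=
    (tendsto_const_div_nat B j).eventually_le_const one_pos
  refine squeeze_zero' (g := fun n : ℕ => (1 / (√((n + 1 + j : ℕ) : ℝ) * rho ξ)) ^ 2)
    (Eventually.of_forall fun n => ?_) ?_ (by simpa using (tendsto_scale (rho ξ) j).pow 2)
  · exact div_nonneg (div_nonneg (mul_self_nonneg _) (Nat.cast_nonneg _)) (kern_self_nonneg _ _)
  · filter_upwards [h1] with n hn
    have hq := (hB n t le_rfl).trans hn
    have hS := weighted_kern_self (n + 1) (√((n + 1 + j : ℕ) : ℝ) * ξ)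
      (1 / (√((n + 1 + j : ℕ) : ℝ) * rho ξ)) t
    set q := hermPot (n + 1) (√((n + 1 + j : ℕ) : ℝ) * ξ)
      (1 / (√((n + 1 + j : ℕ) : ℝ) * rho ξ)) t
    have hq1 : 1 ≤ q := by
      have := (abs_le.1 hq).1; nlinarith [pi_gt_three]
    set a := 1 / (√((n + 1 + j : ℕ) : ℝ) * rho ξ)
    rw [hermFun, ← point_eq] at hS
    set x := point (n + 1 + j) ξ t
    have hx := kern_hermEval_self_pos (n + 1) x
    set k := kern (n + 1) (hermEval x) (hermEval x)
    have hf : (0 : ℝ) < ((n + 1).factorial : ℝ) := by exact_mod_cast (n + 1).factorial_pos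
    set e := exp (-x ^ 2 / 4)
    have he : 0 < e := exp_pos _
    rw [div_div, div_le_iff₀ (by positivity)]
    have h3 : (hermEval x (n + 1) * e) ^ 2 ≤ a ^ 2 * ((n + 1).factorial : ℝ) * e ^ 2 * k := by
      rw [← hS]
      have h4 : 1 ≤ a ^ 2 / 2 + q := by linarith [sq_nonneg a]
      nlinarith [sq_nonneg (hermEval x (n + 1) * e),
        sq_nonneg (hermFunDeriv (n + 1) (√((n + 1 + j : ℕ) : ℝ) * ξ) a t)]
    have h5 : e ^ 2 * (hermEval x (n + 1) * hermEval x (n + 1))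
        ≤ e ^ 2 * (a ^ 2 * (((n + 1).factorial : ℝ) * k)) := by
      calc _ = (hermEval x (n + 1) * e) ^ 2 := by ring
        _ ≤ _ := h3
        _ = _ := by ring
    exact le_of_mul_le_mul_left h5 (by positivity)

/-- Top terms are removed one at a time. The induction hypothesis is used at `1 + j`, which leaves
the evaluation point unchanged. -/
theorem tendsto_kern_div_kern_add {ξ : ℝ} (hξ : ξ ∈ Ioo (-2 : ℝ) 2) (t : ℝ) (i j : ℕ) :
    Tendsto (fun n : ℕ =>
      kern n (hermEval (point (n + i + j) ξ t)) (hermEval (point (n + i + j) ξ t))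
      / kern (n + i) (hermEval (point (n + i + j) ξ t)) (hermEval (point (n + i + j) ξ t)))
      atTop (𝓝 1) := by
  induction i generalizing j with
  | zero =>
    refine tendsto_const_nhds.congr fun n => ?_
    rw [add_zero, div_self (kern_hermEval_self_pos _ _).ne']
  | succ i ih =>
    have h1 := ih (1 + j)
    have h2 := (tendsto_add_atTop_iff_nat (i + 1)).2 (tendsto_herm_sq_div_kern hξ t j)
    have h3 := h1.mul (h2.const_sub 1)
    rw [sub_zero, mul_one] at h3
    refine h3.congr fun n => ?_
    rw [← add_assoc (n + i) 1 j, ← add_assoc n i 1]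
    set x := point (n + i + 1 + j) ξ t
    have k1 := (kern_hermEval_self_pos (n + i) x).ne'
    have k2 := (kern_hermEval_self_pos (n + i + 1) x).ne'
    rw [one_sub_div k2, kern_succ (n + i), add_sub_cancel_right, ← kern_succ,
      div_mul_div_cancel₀ k1]

/-- Term `k` tends to `c^k/k!` times the sine kernel. Cauchy-Schwarz and the monotonicity of the
diagonal kernel in the degree bound it by `|c|^k/k!`, so limit and sum may be exchanged. -/
theorem tendsto_momentForm {ξ : ℝ} (hξ : ξ ∈ Ioo (-2 : ℝ) 2) (c s t : ℝ) :
    Tendsto (fun N : ℕ => momentForm c N (hermEval (point N ξ s)) (hermEval (point N ξ t)) /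
      (N.factorial * √(kern N (hermEval (point N ξ s)) (hermEval (point N ξ s))
        * kern N (hermEval (point N ξ t)) (hermEval (point N ξ t)))))
      atTop (𝓝 (exp c * sinc (π * (s - t)))) := by
  set K : ℕ → ℕ → ℝ → ℝ → ℝ := fun N M s t =>
    kern M (hermEval (point N ξ s)) (hermEval (point N ξ t)) with hK
  have hKpos : ∀ N M s, 0 < K N M s s := fun N M s => kern_hermEval_self_pos _ _
  have hterm : ∀ k : ℕ, Tendsto (fun N => if k < N / 2 + 1 then
      c ^ k / (k.factorial : ℝ) * (K N (N - 2 * k) s t / √(K N N s s * K N N t t)) else 0)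
      atTop (𝓝 (c ^ k / (k.factorial : ℝ) * sinc (π * (s - t)))) := by
    intro k
    -- With `N = n + 2k` the truncated subtraction `N - 2k` becomes `n`, and the condition on `k`
    -- holds.
    rw [← tendsto_add_atTop_iff_nat (2 * k)]
    have h1 := tendsto_kern_ratio hξ s t (2 * k)
    have h2 := (tendsto_kern_div_kern_add hξ s (2 * k) 0).sqrt
    have h3 := (tendsto_kern_div_kern_add hξ t (2 * k) 0).sqrt
    have h4 := ((h1.mul (h2.mul h3)).const_mul (c ^ k / (k.factorial : ℝ)))
    simp only [sqrt_one, mul_one, add_zero] at h4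
    refine h4.congr fun n => ?_
    rw [if_pos (by omega), Nat.add_sub_cancel]
    congr 1
    have p1 := hKpos (n + 2 * k) n s
    have p2 := hKpos (n + 2 * k) n t
    have p3 := hKpos (n + 2 * k) (n + 2 * k) s
    have p4 := hKpos (n + 2 * k) (n + 2 * k) t
    simp only [hK] at p1 p2 p3 p4 ⊢
    rw [← sqrt_mul (by positivity), div_mul_div_comm, sqrt_div (by positivity),
      div_mul_div_cancel₀ (sqrt_pos.2 (by positivity)).ne']
  have hsum : HasSum (fun k : ℕ => c ^ k / (k.factorial : ℝ) * sinc (π * (s - t)))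
      (exp c * sinc (π * (s - t))) := by
    refine HasSum.mul_right _ ?_
    rw [Real.exp_eq_exp_ℝ]
    exact NormedSpace.expSeries_div_hasSum_exp c
  have main := tendsto_tsum_of_dominated_convergence
    (bound := fun k : ℕ => |c| ^ k / (k.factorial : ℝ))
    (Real.summable_pow_div_factorial |c|) hterm (Eventually.of_forall fun N k => by
      split_ifs with h
      · rw [norm_mul, norm_div, norm_pow, Real.norm_eq_abs, Real.norm_natCast]
        refine mul_le_of_le_one_right (by positivity) ?_
        rw [Real.norm_eq_abs, abs_div, abs_of_nonneg (sqrt_nonneg _)]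
        refine div_le_one_of_le₀ ((abs_kern_le _ _ _).trans (sqrt_le_sqrt ?_)) (sqrt_nonneg _)
        exact mul_le_mul (kern_self_mono _ (Nat.sub_le _ _)) (kern_self_mono _ (Nat.sub_le _ _))
          (kern_self_nonneg _ _) (kern_self_nonneg _ _)
      · rw [norm_zero]; positivity)
  rw [hsum.tsum_eq] at main
  refine main.congr fun N => ?_
  rw [tsum_eq_sum (s := Finset.range (N / 2 + 1)) fun k hk => if_neg (by simpa using hk),
    momentForm, mul_div_mul_left _ _ (by exact_mod_cast N.factorial_ne_zero), Finset.sum_div]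
  refine Finset.sum_congr rfl fun k hk => ?_
  rw [if_pos (Finset.mem_range.1 hk), mul_div_assoc]

/-- As `c` may be negative, the sum need not be termwise positive; positivity for large `N` comes
from the limit `exp c > 0`. -/
theorem momentForm_self_pos {ξ : ℝ} (hξ : ξ ∈ Ioo (-2 : ℝ) 2) (c t : ℝ) :
    ∀ᶠ N : ℕ in atTop, 0 < momentForm c N (hermEval (point N ξ t)) (hermEval (point N ξ t)) := by
  have h := tendsto_momentForm hξ c t t
  rw [sub_self, mul_zero, sinc_zero, mul_one] at h
  filter_upwards [h.eventually_const_lt (exp_pos c)] with N hN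
  have h1 := kern_hermEval_self_pos N (point N ξ t)
  have h2 : (0 : ℝ) < (N.factorial : ℝ) := by exact_mod_cast N.factorial_pos
  exact (div_pos_iff_of_pos_right (mul_pos h2 (sqrt_pos.2 (mul_pos h1 h1)))).1 hN

theorem tendsto_momentForm_ratio {ξ : ℝ} (hξ : ξ ∈ Ioo (-2 : ℝ) 2) (c s t : ℝ) :
    Tendsto (fun N : ℕ => momentForm c N (hermEval (point N ξ s)) (hermEval (point N ξ t)) /
      (√(momentForm c N (hermEval (point N ξ s)) (hermEval (point N ξ s)))
        * √(momentForm c N (hermEval (point N ξ t)) (hermEval (point N ξ t)))))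
      atTop (𝓝 (sinc (π * (s - t)))) := by
  have h1 := tendsto_momentForm hξ c s t
  have h2 := (tendsto_momentForm hξ c s s).sqrt
  have h3 := (tendsto_momentForm hξ c t t).sqrt
  rw [sub_self, mul_zero, sinc_zero, mul_one] at h2 h3
  have h4 := h1.div (h2.mul h3) (by positivity)
  -- The factor `exp c`, the only trace of the fourth moment, disappears here.
  rw [mul_self_sqrt (exp_pos c).le, mul_div_cancel_left₀ _ (exp_pos c).ne'] at h4
  refine h4.congr fun N => ?_
  simp only [Pi.div_apply]
  have k1 := kern_hermEval_self_pos N (point N ξ s)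
  have k2 := kern_hermEval_self_pos N (point N ξ t)
  have hN : (0 : ℝ) < (N.factorial : ℝ) := by exact_mod_cast N.factorial_pos
  set A := kern N (hermEval (point N ξ s)) (hermEval (point N ξ s))
  set B := kern N (hermEval (point N ξ t)) (hermEval (point N ξ t))
  rw [sqrt_mul_self k1.le, sqrt_mul_self k2.le, sqrt_div' _ (by positivity),
    sqrt_div' _ (by positivity), div_mul_div_comm, ← sqrt_mul (by positivity : 0 ≤ N.factorial * A),
    show (N.factorial : ℝ) * A * (N.factorial * B) = (N.factorial : ℝ) ^ 2 * (A * B) by ring,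
    sqrt_mul (by positivity) (A * B), sqrt_sq hN.le]
  rw [div_div_div_cancel_right₀]
  positivity

end SineKernel

/-! ### Independence by matrix position, and square integrability -/

section Independence

/-- The entry in position `(i, j)` of the infinite Wigner matrix. -/
noncomputable def entry {Ω : Type*} (Xdiag : ℕ → Ω → ℝ) (Xre Xim : ℕ → ℕ → Ω → ℝ)
    (i j : ℕ) (ω : Ω) : ℂ :=
  if i < j then (Xre i j ω : ℂ) + Complex.I * (Xim i j ω : ℂ)
  else if j < i then (Xre j i ω : ℂ) - Complex.I * (Xim j i ω : ℂ)
  else (Xdiag i ω : ℂ)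

/-- The unordered matrix position at which a real random variable of the family is used. -/
def position : EntryIndex → Sym2 ℕ :=
  Sum.elim (fun i => s(i, i)) (Sum.elim (fun p => s(p.1.1, p.1.2)) (fun p => s(p.1.1, p.1.2)))

/-- The σ-algebra generated by the entries in a set of unordered positions. -/
noncomputable abbrev sigmaOf {Ω : Type*} (Xdiag : ℕ → Ω → ℝ) (Xre Xim : ℕ → ℕ → Ω → ℝ)
    (A : Set (Sym2 ℕ)) : MeasurableSpace Ω :=
  ⨆ k ∈ position ⁻¹' A, (inferInstance : MeasurableSpace ℝ).comap (entries Xdiag Xre Xim k)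

variable {Ω : Type*} {Xdiag : ℕ → Ω → ℝ} {Xre Xim : ℕ → ℕ → Ω → ℝ}

theorem entry_of_lt {i j : ℕ} (h : i < j) (ω : Ω) : entry Xdiag Xre Xim i j ω =
    (entries Xdiag Xre Xim (Sum.inr (Sum.inl ⟨(i, j), h⟩)) ω : ℂ)
      + Complex.I * (entries Xdiag Xre Xim (Sum.inr (Sum.inr ⟨(i, j), h⟩)) ω : ℂ) := by
  simp [entry, entries, h]

theorem entry_of_gt {i j : ℕ} (h : i < j) (ω : Ω) : entry Xdiag Xre Xim j i ω =
    (entries Xdiag Xre Xim (Sum.inr (Sum.inl ⟨(i, j), h⟩)) ω : ℂ)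
      - Complex.I * (entries Xdiag Xre Xim (Sum.inr (Sum.inr ⟨(i, j), h⟩)) ω : ℂ) := by
  simp [entry, entries, h, h.not_gt]

theorem entry_self (i : ℕ) (ω : Ω) : entry Xdiag Xre Xim i i ω =
    ((√2 * entries Xdiag Xre Xim (Sum.inl i) ω : ℝ) : ℂ) := by
  simp only [entry, entries, lt_self_iff_false, if_false, Sum.elim_inl]
  rw [mul_div_cancel₀ _ (by positivity)]

theorem norm_entry_comm (i j : ℕ) (ω : Ω) :
    ‖entry Xdiag Xre Xim i j ω‖ = ‖entry Xdiag Xre Xim j i ω‖ := by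
  have key : ∀ i j : ℕ, i < j →
      ‖entry Xdiag Xre Xim i j ω‖ = ‖entry Xdiag Xre Xim j i ω‖ := by
    intro i j h
    rw [entry_of_lt h, entry_of_gt h, ← Complex.norm_conj]
    simp [sub_eq_add_neg]
  rcases lt_trichotomy i j with h | h | h
  · exact key i j h
  · rw [h]
  · exact (key j i h).symm

theorem sigmaOf_mono {A B : Set (Sym2 ℕ)} (h : A ⊆ B) :
    sigmaOf Xdiag Xre Xim A ≤ sigmaOf Xdiag Xre Xim B :=
  biSup_mono fun _ hk => h hk

theorem measurable_entries_sigmaOf {A : Set (Sym2 ℕ)} {k : EntryIndex} (h : position k ∈ A) :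
    Measurable[sigmaOf Xdiag Xre Xim A] (entries Xdiag Xre Xim k) :=
  measurable_iff_comap_le.2 (le_iSup₂ (f := fun (k : EntryIndex) (_ : k ∈ position ⁻¹' A) =>
    (inferInstance : MeasurableSpace ℝ).comap (entries Xdiag Xre Xim k)) k h)

theorem measurable_entry_sigmaOf {A : Set (Sym2 ℕ)} {i j : ℕ} (h : s(i, j) ∈ A) :
    Measurable[sigmaOf Xdiag Xre Xim A] (entry Xdiag Xre Xim i j) := by
  let _ : MeasurableSpace Ω := sigmaOf Xdiag Xre Xim A
  have h' : s(j, i) ∈ A := by rwa [Sym2.eq_swap]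
  rcases lt_trichotomy i j with hij | hij | hij
  · have m1 := measurable_entries_sigmaOf (Xdiag := Xdiag) (Xre := Xre) (Xim := Xim)
      (k := Sum.inr (Sum.inl ⟨(i, j), hij⟩)) h
    have m2 := measurable_entries_sigmaOf (Xdiag := Xdiag) (Xre := Xre) (Xim := Xim)
      (k := Sum.inr (Sum.inr ⟨(i, j), hij⟩)) h
    rw [show entry Xdiag Xre Xim i j = _ from funext (entry_of_lt hij)]
    exact (Complex.measurable_ofReal.comp m1).add
      ((Complex.measurable_ofReal.comp m2).const_mul _)
  · subst hij
    have m1 := measurable_entries_sigmaOf (Xdiag := Xdiag) (Xre := Xre) (Xim := Xim)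
      (k := Sum.inl i) h
    rw [show entry Xdiag Xre Xim i i = _ from funext (entry_self i)]
    exact Complex.measurable_ofReal.comp (m1.const_mul _)
  · have m1 := measurable_entries_sigmaOf (Xdiag := Xdiag) (Xre := Xre) (Xim := Xim)
      (k := Sum.inr (Sum.inl ⟨(j, i), hij⟩)) h'
    have m2 := measurable_entries_sigmaOf (Xdiag := Xdiag) (Xre := Xre) (Xim := Xim)
      (k := Sum.inr (Sum.inr ⟨(j, i), hij⟩)) h'
    rw [show entry Xdiag Xre Xim i j = _ from funext (entry_of_gt hij)]
    exact (Complex.measurable_ofReal.comp m1).sub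
      ((Complex.measurable_ofReal.comp m2).const_mul _)

theorem measurable_entry_mul {S : Set (Sym2 ℕ)} {i j k l : ℕ} (h1 : s(i, j) ∈ S)
    (h2 : s(k, l) ∈ S) : Measurable[sigmaOf Xdiag Xre Xim S]
      (fun ω => entry Xdiag Xre Xim i j ω * entry Xdiag Xre Xim k l ω) :=
  (measurable_entry_sigmaOf h1).mul (measurable_entry_sigmaOf h2)

theorem measurable_entry_mul_mul {S : Set (Sym2 ℕ)} {i j k l m n : ℕ} (h1 : s(i, j) ∈ S)
    (h2 : s(k, l) ∈ S) (h3 : s(m, n) ∈ S) : Measurable[sigmaOf Xdiag Xre Xim S]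
      (fun ω => entry Xdiag Xre Xim i j ω * entry Xdiag Xre Xim k l ω
        * entry Xdiag Xre Xim m n ω) :=
  (measurable_entry_mul h1 h2).mul (measurable_entry_sigmaOf h3)

variable [mΩ : MeasurableSpace Ω] {P : Measure Ω} {Q : Measure ℝ}

theorem IsWignerFamily.sigmaOf_le (hX : IsWignerFamily P Q Xdiag Xre Xim) (A : Set (Sym2 ℕ)) :
    sigmaOf Xdiag Xre Xim A ≤ mΩ :=
  iSup₂_le fun k _ => (hX.measurable k).comap_le

/-- Unordered positions are the right index: `X i j` and `X j i` are built from the same two real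
variables, while disjoint sets of positions use disjoint parts of the family. -/
theorem IsWignerFamily.indepFun (hX : IsWignerFamily P Q Xdiag Xre Xim) {A B : Set (Sym2 ℕ)}
    (hAB : Disjoint A B) {β γ : Type*} [MeasurableSpace β] [MeasurableSpace γ]
    {f : Ω → β} {g : Ω → γ} (hf : Measurable[sigmaOf Xdiag Xre Xim A] f)
    (hg : Measurable[sigmaOf Xdiag Xre Xim B] g) : IndepFun f g P := by
  rw [IndepFun_iff_Indep]
  have h := indep_iSup_of_disjoint (fun k => (hX.measurable k).comap_le)
    ((iIndepFun_iff_iIndep _ _ _).1 hX.indep) (hAB.preimage position)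
  exact indep_of_indep_of_le h hf.comap_le hg.comap_le

theorem IsWignerFamily.integral_mul (hX : IsWignerFamily P Q Xdiag Xre Xim)
    {A B : Set (Sym2 ℕ)} (hAB : Disjoint A B) {f g : Ω → ℂ}
    (hf : Measurable[sigmaOf Xdiag Xre Xim A] f)
    (hg : Measurable[sigmaOf Xdiag Xre Xim B] g) :
    ∫ ω, f ω * g ω ∂P = (∫ ω, f ω ∂P) * ∫ ω, g ω ∂P :=
  (hX.indepFun hAB hf hg).integral_fun_mul_eq_mul_integral
    (hf.mono (hX.sigmaOf_le A) le_rfl).aestronglyMeasurable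
    (hg.mono (hX.sigmaOf_le B) le_rfl).aestronglyMeasurable

theorem IsWignerFamily.integrable_mul (hX : IsWignerFamily P Q Xdiag Xre Xim)
    {A B : Set (Sym2 ℕ)} (hAB : Disjoint A B) {f g : Ω → ℂ}
    (hf : Measurable[sigmaOf Xdiag Xre Xim A] f)
    (hg : Measurable[sigmaOf Xdiag Xre Xim B] g) (hfi : Integrable f P) (hgi : Integrable g P) :
    Integrable (fun ω => f ω * g ω) P :=
  (hX.indepFun hAB hf hg).integrable_mul hfi hgi

theorem measurable_det {n : Type*} [Fintype n] [DecidableEq n]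
    {A : Ω → Matrix n n ℂ} (hA : ∀ i j, Measurable fun ω => A ω i j) :
    Measurable fun ω => (A ω).det := by
  simp only [Matrix.det_apply']
  exact Finset.measurable_sum _ fun σ _ => (Finset.measurable_prod _ fun i _ => hA _ _).const_mul _

/-! ### Integrability -/

instance holderTriple_four_four_two : ENNReal.HolderTriple 4 4 2 where
  inv_add_inv_eq_inv := by
    rw [← two_mul, show (4 : ENNReal) = 2 * 2 by norm_num,
      ENNReal.mul_inv (by simp) (by simp), ← mul_assoc,
      ENNReal.mul_inv_cancel (by simp) (by simp), one_mul]

theorem IsWignerFamily.integral_comp (hX : IsWignerFamily P Q Xdiag Xre Xim) (k : EntryIndex)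
    {f : ℝ → ℝ} (hf : Measurable f) :
    ∫ ω, f (entries Xdiag Xre Xim k ω) ∂P = ∫ x, f x ∂Q := by
  rw [← hX.law k, integral_map (hX.measurable k).aemeasurable hf.aestronglyMeasurable]

theorem IsWignerFamily.memLp_entries (hX : IsWignerFamily P Q Xdiag Xre Xim)
    (hQ : MomentConditions Q) (k : EntryIndex) : MemLp (entries Xdiag Xre Xim k) 4 P := by
  have h1 : MemLp (fun x : ℝ => x) 4 Q := by
    rw [← integrable_norm_rpow_iff measurable_id'.aestronglyMeasurable (by simp) (by simp)]
    refine hQ.fourth.congr (Eventually.of_forall fun x => ?_)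
    have : (ENNReal.toReal 4) = ((4 : ℕ) : ℝ) := by simp
    simp only [this, Real.rpow_natCast, Real.norm_eq_abs]
    exact (Even.pow_abs (by decide) x).symm
  rw [← hX.law k] at h1
  exact h1.comp_of_map (hX.measurable k).aemeasurable

theorem IsWignerFamily.memLp_entry (hX : IsWignerFamily P Q Xdiag Xre Xim)
    (hQ : MomentConditions Q) (i j : ℕ) : MemLp (entry Xdiag Xre Xim i j) 4 P := by
  have hr : ∀ k, MemLp (fun ω => (entries Xdiag Xre Xim k ω : ℂ)) 4 P :=
    fun k => (hX.memLp_entries hQ k).ofReal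
  rcases lt_trichotomy i j with h | h | h
  · rw [funext (entry_of_lt h)]
    exact (hr _).add ((hr _).const_mul Complex.I)
  · subst h
    rw [funext (entry_self i)]
    simp only [Complex.ofReal_mul]
    exact (hr _).const_mul _
  · rw [funext (entry_of_gt h)]
    exact (hr _).sub ((hr _).const_mul Complex.I)

/-- The absolute value of the entries in an unordered position. -/
noncomputable def normEntry (Xdiag : ℕ → Ω → ℝ) (Xre Xim : ℕ → ℕ → Ω → ℝ) (ω : Ω) :
    Sym2 ℕ → ℝ :=
  Sym2.lift ⟨fun i j => ‖entry Xdiag Xre Xim i j ω‖, fun i j => norm_entry_comm i j ω⟩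

/-- Independence takes the place of Hölder's inequality, so any number of `L²` factors at different
positions has a product in `L²`. -/
theorem IsWignerFamily.memLp_prod [IsProbabilityMeasure P]
    (hX : IsWignerFamily P Q Xdiag Xre Xim)
    {Y : Sym2 ℕ → Ω → ℝ} (hm : ∀ q, Measurable[sigmaOf Xdiag Xre Xim {q}] (Y q))
    (hL : ∀ q, MemLp (Y q) 2 P) (s : Finset (Sym2 ℕ)) :
    Measurable[sigmaOf Xdiag Xre Xim s] (fun ω => ∏ q ∈ s, Y q ω) ∧
      MemLp (fun ω => ∏ q ∈ s, Y q ω) 2 P := by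
  induction s using Finset.induction_on with
  | empty =>
    simp only [Finset.prod_empty]
    exact ⟨measurable_const, memLp_const _⟩
  | insert q s hq ih =>
    simp only [Finset.prod_insert hq]
    have m1 : Measurable[sigmaOf Xdiag Xre Xim ↑(insert q s)] (Y q) :=
      (hm q).mono (sigmaOf_mono (by simp)) le_rfl
    have m2 : Measurable[sigmaOf Xdiag Xre Xim ↑(insert q s)] (fun ω => ∏ q ∈ s, Y q ω) :=
      ih.1.mono (sigmaOf_mono (by simp)) le_rfl
    have m : Measurable[sigmaOf Xdiag Xre Xim ↑(insert q s)]
        (fun ω => Y q ω * ∏ q ∈ s, Y q ω) := m1.mul m2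
    refine ⟨m, (memLp_two_iff_integrable_sq
      (m.mono (hX.sigmaOf_le _) le_rfl).aestronglyMeasurable).2 ?_⟩
    simp only [mul_pow]
    have hd : Disjoint ({q} : Set (Sym2 ℕ)) ↑s := by simpa using hq
    have hi := (hX.indepFun hd (hm q) ih.1).comp (φ := fun x : ℝ => x ^ 2)
      (ψ := fun x : ℝ => x ^ 2) (by fun_prop) (by fun_prop)
    exact hi.integrable_mul (hL q).integrable_sq ih.2.integrable_sq

/-- If `j` has the same unordered position as `i`, then `e j` is one of `e i`, `e (σ i)`. Hence a
product over a permutation contains each position at most twice, and four moments of the entries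
suffice. -/
theorem card_fiber_le_two {N : ℕ} {e : Fin N → ℕ} (he : Function.Injective e)
    (σ : Fin N → Fin N) (q : Sym2 ℕ) :
    (Finset.univ.filter fun i => s(e i, e (σ i)) = q).card ≤ 2 := by
  rcases Finset.eq_empty_or_nonempty (Finset.univ.filter fun i => s(e i, e (σ i)) = q)
    with h | ⟨i, hi⟩
  · simp [h]
  · have hi' := (Finset.mem_filter.1 hi).2
    refine (Finset.card_le_card (t := {i, σ i}) fun j hj => ?_).trans Finset.card_le_two
    have hj' := (Finset.mem_filter.1 hj).2
    have : e j ∈ s(e i, e (σ i)) := by rw [hi', ← hj']; simp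
    rw [Sym2.mem_iff, he.eq_iff, he.eq_iff] at this
    simpa using this

/-- A determinant whose entries are dominated by those of a Wigner matrix is square integrable. -/
theorem IsWignerFamily.memLp_det [IsProbabilityMeasure P]
    (hX : IsWignerFamily P Q Xdiag Xre Xim) (hQ : MomentConditions Q) {N : ℕ} {e : Fin N → ℕ}
    (he : Function.Injective e) {A : Ω → Matrix (Fin N) (Fin N) ℂ}
    (hA : ∀ i j, Measurable fun ω => A ω i j) (C : ℝ)
    (hb : ∀ i j ω, ‖A ω i j‖ ≤ C + ‖entry Xdiag Xre Xim (e i) (e j) ω‖) :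
    MemLp (fun ω => (A ω).det) 2 P := by
  -- The maximum with `1` makes `Z ≥ 1`, so raising the exponent to `2` at every visited position
  -- only enlarges the product.
  set Z : Sym2 ℕ → Ω → ℝ := fun q ω => max C 1 + normEntry Xdiag Xre Xim ω q with hZ
  have hZ1 : ∀ q ω, 1 ≤ Z q ω := fun q ω => by
    refine (le_max_right C 1).trans (le_add_of_nonneg_right ?_)
    induction q using Sym2.ind with
    | _ i j => exact norm_nonneg (entry Xdiag Xre Xim i j ω)
  have hZm : ∀ q, Measurable[sigmaOf Xdiag Xre Xim {q}] (Z q) := fun q => by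
    induction q using Sym2.ind with
    | _ i j =>
      have := measurable_entry_sigmaOf (Xdiag := Xdiag) (Xre := Xre) (Xim := Xim)
        (Set.mem_singleton s(i, j))
      exact (measurable_norm.const_add (max C 1)).comp this
  have hZ4 : ∀ q, MemLp (Z q) 4 P := fun q => by
    induction q using Sym2.ind with
    | _ i j => exact (memLp_const (max C 1)).add (hX.memLp_entry hQ i j).norm
  have hprod := hX.memLp_prod (Y := fun q ω => Z q ω * Z q ω) (fun q => (hZm q).mul (hZm q))
    (fun q => (hZ4 q).mul (hZ4 q))
  simp only [Matrix.det_apply']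
  refine memLp_finsetSum _ fun σ _ => MemLp.const_mul ?_ _
  set s := Finset.univ.image fun i => s(e i, e (σ i))
  refine (hprod s).2.mono (Finset.measurable_prod _ fun i _ => hA _ _).aestronglyMeasurable
    (Eventually.of_forall fun ω => ?_)
  rw [norm_prod, Real.norm_of_nonneg (Finset.prod_nonneg fun q _ => mul_self_nonneg _)]
  calc ∏ i, ‖A ω (σ i) i‖ ≤ ∏ i, Z s(e i, e (σ i)) ω := by
        refine Finset.prod_le_prod (fun _ _ => norm_nonneg _) fun i _ => ?_
        refine (hb _ _ ω).trans ?_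
        rw [norm_entry_comm]
        exact add_le_add_left (le_max_left _ _) _
    _ = ∏ q ∈ s, Z q ω ^ (Finset.univ.filter fun i => s(e i, e (σ i)) = q).card :=
        Finset.prod_comp (fun q => Z q ω) _
    _ ≤ ∏ q ∈ s, Z q ω * Z q ω := by
        refine Finset.prod_le_prod (fun q _ => by have := hZ1 q ω; positivity) fun q _ => ?_
        rw [← sq]
        exact pow_le_pow_right₀ (hZ1 q ω) (card_fiber_le_two he σ q)

end Independence

/-! ### Mixed moments of the entries up to order four -/

section Moments

variable {Ω : Type*} {Xdiag : ℕ → Ω → ℝ} {Xre Xim : ℕ → ℕ → Ω → ℝ}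
  [mΩ : MeasurableSpace Ω] {P : Measure Ω} {Q : Measure ℝ}

theorem IsWignerFamily.integral_entries (hX : IsWignerFamily P Q Xdiag Xre Xim)
    (hQ : MomentConditions Q) (k : EntryIndex) : ∫ ω, entries Xdiag Xre Xim k ω ∂P = 0 :=
  (hX.integral_comp k measurable_id').trans hQ.mean

theorem IsWignerFamily.integral_entries_sq (hX : IsWignerFamily P Q Xdiag Xre Xim)
    (hQ : MomentConditions Q) (k : EntryIndex) :
    ∫ ω, entries Xdiag Xre Xim k ω ^ 2 ∂P = 1 / 2 :=
  (hX.integral_comp k (f := fun x => x ^ 2) (by fun_prop)).trans hQ.variance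

theorem IsWignerFamily.memLp_two_entries [IsProbabilityMeasure P]
    (hX : IsWignerFamily P Q Xdiag Xre Xim)
    (hQ : MomentConditions Q) (k : EntryIndex) : MemLp (entries Xdiag Xre Xim k) 2 P :=
  (hX.memLp_entries hQ k).mono_exponent (by norm_num)

theorem IsWignerFamily.memLp_two_entry [IsProbabilityMeasure P]
    (hX : IsWignerFamily P Q Xdiag Xre Xim)
    (hQ : MomentConditions Q) (i j : ℕ) : MemLp (entry Xdiag Xre Xim i j) 2 P :=
  (hX.memLp_entry hQ i j).mono_exponent (by norm_num)

theorem IsWignerFamily.integrable_entries_ofReal [IsProbabilityMeasure P]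
    (hX : IsWignerFamily P Q Xdiag Xre Xim)
    (hQ : MomentConditions Q) (k : EntryIndex) :
    Integrable (fun ω => (entries Xdiag Xre Xim k ω : ℂ)) P :=
  ((hX.memLp_two_entries hQ k).integrable one_le_two).ofReal

theorem IsWignerFamily.integral_entry [IsProbabilityMeasure P]
    (hX : IsWignerFamily P Q Xdiag Xre Xim)
    (hQ : MomentConditions Q) (i j : ℕ) : ∫ ω, entry Xdiag Xre Xim i j ω ∂P = 0 := by
  have hi := hX.integrable_entries_ofReal hQ
  have h0 : ∀ k, ∫ ω, (entries Xdiag Xre Xim k ω : ℂ) ∂P = 0 := fun k => by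
    rw [integral_complex_ofReal, hX.integral_entries hQ, Complex.ofReal_zero]
  rcases lt_trichotomy i j with h | h | h
  · rw [funext (entry_of_lt h), integral_add (hi _) ((hi _).const_mul _), integral_const_mul,
      h0, h0, mul_zero, add_zero]
  · subst h
    rw [funext (entry_self i)]
    simp only [Complex.ofReal_mul]
    rw [integral_const_mul, h0, mul_zero]
  · rw [funext (entry_of_gt h), integral_sub (hi _) ((hi _).const_mul _), integral_const_mul,
      h0, h0, mul_zero, sub_zero]

theorem IsWignerFamily.integral_entry_self_sq (hX : IsWignerFamily P Q Xdiag Xre Xim)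
    (hQ : MomentConditions Q) (i : ℕ) :
    ∫ ω, entry Xdiag Xre Xim i i ω * entry Xdiag Xre Xim i i ω ∂P = 1 := by
  rw [funext (entry_self i)]
  have : ∀ ω, ((√2 * entries Xdiag Xre Xim (Sum.inl i) ω : ℝ) : ℂ)
      * ((√2 * entries Xdiag Xre Xim (Sum.inl i) ω : ℝ) : ℂ)
      = ((2 * entries Xdiag Xre Xim (Sum.inl i) ω ^ 2 : ℝ) : ℂ) := fun ω => by
    rw [← Complex.ofReal_mul]
    congr 1
    rw [mul_mul_mul_comm, Real.mul_self_sqrt (by norm_num)]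
    ring
  simp only [this]
  rw [integral_complex_ofReal, integral_const_mul, hX.integral_entries_sq hQ]
  norm_num

theorem IsWignerFamily.integral_entries_mul (hX : IsWignerFamily P Q Xdiag Xre Xim)
    {k l : EntryIndex} (hkl : k ≠ l) {f g : ℝ → ℝ} (hf : Measurable f) (hg : Measurable g) :
    ∫ ω, f (entries Xdiag Xre Xim k ω) * g (entries Xdiag Xre Xim l ω) ∂P
      = (∫ x, f x ∂Q) * ∫ x, g x ∂Q := by
  rw [← hX.integral_comp k hf, ← hX.integral_comp l hg]
  exact ((hX.indep.indepFun hkl).comp hf hg).integral_fun_mul_eq_mul_integral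
    (hf.comp (hX.measurable k)).aestronglyMeasurable
    (hg.comp (hX.measurable l)).aestronglyMeasurable

theorem inl_ne_inr_position (p : {p : ℕ × ℕ // p.1 < p.2}) :
    (Sum.inr (Sum.inl p) : EntryIndex) ≠ Sum.inr (Sum.inr p) := by simp

theorem IsWignerFamily.integral_entry_mul_swap [IsProbabilityMeasure P]
    (hX : IsWignerFamily P Q Xdiag Xre Xim)
    (hQ : MomentConditions Q) {i j : ℕ} (h : i < j) :
    ∫ ω, entry Xdiag Xre Xim j i ω * entry Xdiag Xre Xim i j ω ∂P = 1 := by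
  rw [funext (entry_of_lt h), funext (entry_of_gt h)]
  set R := entries Xdiag Xre Xim (Sum.inr (Sum.inl ⟨(i, j), h⟩)) with hR
  set M := entries Xdiag Xre Xim (Sum.inr (Sum.inr ⟨(i, j), h⟩)) with hM
  have e : ∀ ω, ((R ω : ℂ) - Complex.I * M ω) * ((R ω : ℂ) + Complex.I * M ω)
      = ((R ω ^ 2 + M ω ^ 2 : ℝ) : ℂ) := fun ω => by
    push_cast
    linear_combination (-(M ω : ℂ) ^ 2) * Complex.I_sq
  simp only [e]
  rw [integral_complex_ofReal, integral_add (hX.memLp_two_entries hQ _).integrable_sq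
    (hX.memLp_two_entries hQ _).integrable_sq, hX.integral_entries_sq hQ,
    hX.integral_entries_sq hQ]
  norm_num

/-- Real and imaginary part have the same variance and are uncorrelated. This kills the pairings of
row with row and of column with column in the fourth moments. -/
theorem IsWignerFamily.integral_entry_sq [IsProbabilityMeasure P]
    (hX : IsWignerFamily P Q Xdiag Xre Xim)
    (hQ : MomentConditions Q) {i j : ℕ} (h : i ≠ j) :
    ∫ ω, entry Xdiag Xre Xim i j ω * entry Xdiag Xre Xim i j ω ∂P = 0 := by
  have key : ∀ (p : {p : ℕ × ℕ // p.1 < p.2}) (c : ℂ), c ^ 2 = -1 →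
      ∫ ω, ((entries Xdiag Xre Xim (Sum.inr (Sum.inl p)) ω : ℂ)
          + c * entries Xdiag Xre Xim (Sum.inr (Sum.inr p)) ω)
        * ((entries Xdiag Xre Xim (Sum.inr (Sum.inl p)) ω : ℂ)
          + c * entries Xdiag Xre Xim (Sum.inr (Sum.inr p)) ω) ∂P = 0 := by
    intro p c hc
    have hRM := hX.integral_entries_mul (inl_ne_inr_position p) measurable_id' measurable_id'
    set R := entries Xdiag Xre Xim (Sum.inr (Sum.inl p)) with hR
    set M := entries Xdiag Xre Xim (Sum.inr (Sum.inr p)) with hM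
    have e : ∀ ω, ((R ω : ℂ) + c * M ω) * ((R ω : ℂ) + c * M ω)
        = ((R ω ^ 2 - M ω ^ 2 : ℝ) : ℂ) + 2 * c * ((R ω * M ω : ℝ) : ℂ) := fun ω => by
      push_cast
      linear_combination ((M ω : ℂ) ^ 2) * hc
    have i1 : Integrable (fun ω => R ω ^ 2) P := (hX.memLp_two_entries hQ _).integrable_sq
    have i2 : Integrable (fun ω => M ω ^ 2) P := (hX.memLp_two_entries hQ _).integrable_sq
    have i3 : Integrable (fun ω => R ω * M ω) P :=
      (hX.memLp_two_entries hQ _).integrable_mul (hX.memLp_two_entries hQ _)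
    simp only [e]
    rw [integral_add (i1.sub i2).ofReal (i3.ofReal.const_mul _), integral_const_mul,
      integral_complex_ofReal, integral_complex_ofReal, integral_sub i1 i2, hRM, hQ.mean,
      hX.integral_entries_sq hQ, hX.integral_entries_sq hQ]
    simp
  rcases h.lt_or_gt with h | h
  · rw [funext (entry_of_lt h)]
    exact key _ Complex.I Complex.I_sq
  · rw [funext (entry_of_gt h)]
    simpa [sub_eq_add_neg] using key ⟨(j, i), h⟩ (-Complex.I) (by simp)

theorem IsWignerFamily.integral_entry_mul_swap_sq [IsProbabilityMeasure P]
    (hX : IsWignerFamily P Q Xdiag Xre Xim)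
    (hQ : MomentConditions Q) {i j : ℕ} (h : i < j) :
    ∫ ω, entry Xdiag Xre Xim j i ω * entry Xdiag Xre Xim i j ω
      * (entry Xdiag Xre Xim j i ω * entry Xdiag Xre Xim i j ω) ∂P
      = ((2 * (∫ x, x ^ 4 ∂Q) + 1 / 2 : ℝ) : ℂ) := by
  rw [funext (entry_of_lt h), funext (entry_of_gt h)]
  have hRM := hX.integral_entries_mul (inl_ne_inr_position ⟨(i, j), h⟩)
    (f := fun x => x ^ 2) (g := fun x => x ^ 2) (by fun_prop) (by fun_prop)
  have h4 : ∀ k, ∫ ω, entries Xdiag Xre Xim k ω ^ 4 ∂P = ∫ x, x ^ 4 ∂Q := fun k =>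
    hX.integral_comp k (f := fun x => x ^ 4) (by fun_prop)
  have hi2 : ∀ k, MemLp (fun ω => entries Xdiag Xre Xim k ω ^ 2) 2 P := fun k => by
    simp only [sq]
    exact (hX.memLp_entries hQ k).mul (hX.memLp_entries hQ k)
  have hi4 : ∀ k, Integrable (fun ω => entries Xdiag Xre Xim k ω ^ 4) P := fun k => by
    refine (hi2 k).integrable_sq.congr (Eventually.of_forall fun ω => ?_)
    simp only
    ring
  set R := entries Xdiag Xre Xim (Sum.inr (Sum.inl ⟨(i, j), h⟩)) with hR
  set M := entries Xdiag Xre Xim (Sum.inr (Sum.inr ⟨(i, j), h⟩)) with hM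
  have e : ∀ ω, ((R ω : ℂ) - Complex.I * M ω) * ((R ω : ℂ) + Complex.I * M ω)
      * (((R ω : ℂ) - Complex.I * M ω) * ((R ω : ℂ) + Complex.I * M ω))
      = ((R ω ^ 4 + M ω ^ 4 + 2 * (R ω ^ 2 * M ω ^ 2) : ℝ) : ℂ) := fun ω => by
    have : ((R ω : ℂ) - Complex.I * M ω) * ((R ω : ℂ) + Complex.I * M ω)
        = (R ω : ℂ) ^ 2 + (M ω : ℂ) ^ 2 := by
      linear_combination (-(M ω : ℂ) ^ 2) * Complex.I_sq
    rw [this]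
    push_cast
    ring
  have i1 : Integrable (fun ω => R ω ^ 4) P := hi4 _
  have i2 : Integrable (fun ω => M ω ^ 4) P := hi4 _
  have i12 : Integrable (fun ω => R ω ^ 4 + M ω ^ 4) P := i1.add i2
  have i3 : Integrable (fun ω => R ω ^ 2 * M ω ^ 2) P := (hi2 _).integrable_mul (hi2 _)
  simp only [e]
  rw [integral_complex_ofReal, integral_add i12 (i3.const_mul 2),
    integral_add i1 i2, h4, h4, integral_const_mul, hRM, hQ.variance]
  congr 1
  ring

theorem IsWignerFamily.integral_entry_mul_eq_zero [IsProbabilityMeasure P]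
    (hX : IsWignerFamily P Q Xdiag Xre Xim)
    (hQ : MomentConditions Q) {i j : ℕ} {S : Set (Sym2 ℕ)} (h : s(i, j) ∉ S) {g : Ω → ℂ}
    (hg : Measurable[sigmaOf Xdiag Xre Xim S] g) :
    ∫ ω, entry Xdiag Xre Xim i j ω * g ω ∂P = 0 := by
  rw [hX.integral_mul (Set.disjoint_singleton_left.2 h)
    (measurable_entry_sigmaOf (Set.mem_singleton s(i, j))) hg, hX.integral_entry hQ, zero_mul]

theorem IsWignerFamily.integral_row_mul_col [IsProbabilityMeasure P]
    (hX : IsWignerFamily P Q Xdiag Xre Xim)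
    (hQ : MomentConditions Q) {L i j : ℕ} (hi : i < L) :
    ∫ ω, entry Xdiag Xre Xim L i ω * entry Xdiag Xre Xim j L ω ∂P
      = if i = j then 1 else 0 := by
  split_ifs with h
  · subst h
    exact hX.integral_entry_mul_swap hQ hi
  · refine hX.integral_entry_mul_eq_zero hQ (S := {s(j, L)}) ?_
      (measurable_entry_sigmaOf (Set.mem_singleton _))
    rw [Set.mem_singleton_iff, Sym2.eq_swap, Sym2.congr_left]
    exact h

/-- The fourth order mixed moments of the last row and the last column. -/
theorem IsWignerFamily.integral_row_mul_col_mul_row_mul_col [IsProbabilityMeasure P]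
    (hX : IsWignerFamily P Q Xdiag Xre Xim)
    (hQ : MomentConditions Q) {L i j k l : ℕ} (hi : i < L) (hj : j < L) (hk : k < L) :
    ∫ ω, entry Xdiag Xre Xim L i ω * entry Xdiag Xre Xim j L ω
      * (entry Xdiag Xre Xim L k ω * entry Xdiag Xre Xim l L ω) ∂P
      = (if i = j ∧ k = l then 1 else 0) + (if i = l ∧ j = k then 1 else 0)
        + (if i = j ∧ j = k ∧ k = l then 2 * (((∫ x, x ^ 4 ∂Q) - 3 / 4 : ℝ) : ℂ) else 0) := by
  set w : ℕ → Ω → ℂ := fun i => entry Xdiag Xre Xim L i with hw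
  set v : ℕ → Ω → ℂ := fun i => entry Xdiag Xre Xim i L with hv
  change ∫ ω, w i ω * v j ω * (w k ω * v l ω) ∂P = _
  have hswap : ∀ a, s(L, a) = s(a, L) := fun a => Sym2.eq_swap
  have mem : ∀ a b : ℕ, s(L, a) ∈ ({s(b, L)} : Set (Sym2 ℕ)) ↔ a = b := fun a b => by
    rw [Set.mem_singleton_iff, hswap, Sym2.congr_left]
  have mem' : ∀ a b : ℕ, s(a, L) ∈ ({s(b, L)} : Set (Sym2 ℕ)) ↔ a = b := fun a b => by
    rw [Set.mem_singleton_iff, Sym2.congr_left]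
  have hpair : ∀ a b, a < L → b < L → a ≠ b →
      ∫ ω, (w a ω * v a ω) * (w b ω * v b ω) ∂P = 1 := by
    intro a b ha hb hab
    rw [hX.integral_mul (A := {s(a, L)}) (B := {s(b, L)})
      (Set.disjoint_singleton.2 (by rwa [Ne, Sym2.congr_left]))
      (measurable_entry_mul ((mem a a).2 rfl) ((mem' a a).2 rfl))
      (measurable_entry_mul ((mem b b).2 rfl) ((mem' b b).2 rfl)),
      hX.integral_entry_mul_swap hQ ha, hX.integral_entry_mul_swap hQ hb, one_mul]
  have hpos : ∀ a b c d : ℕ, s(a, L) ∈ ({s(b, L), s(c, L), s(d, L)} : Set (Sym2 ℕ))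
      ↔ a = b ∨ a = c ∨ a = d := fun a b c d => by
    simp only [Set.mem_insert_iff, Set.mem_singleton_iff, Sym2.congr_left]
  have hpos' : ∀ a b c d : ℕ, s(L, a) ∈ ({s(b, L), s(c, L), s(d, L)} : Set (Sym2 ℕ))
      ↔ a = b ∨ a = c ∨ a = d := fun a b c d => by
    rw [hswap, hpos]
  -- A factor whose index occurs only once is centred and independent of the other three, so only
  -- complete pairings contribute.
  have isoV : ∀ a b c d, a ≠ b → a ≠ c → a ≠ d →
      ∫ ω, v a ω * (w b ω * w c ω * v d ω) ∂P = 0 := fun a b c d h1 h2 h3 =>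
    hX.integral_entry_mul_eq_zero hQ (S := {s(b, L), s(c, L), s(d, L)})
      (by rw [hpos]; tauto)
      (measurable_entry_mul_mul (by simp [hpos']) (by simp [hpos']) (by simp [hpos]))
  have isoW : ∀ a b c d, a ≠ b → a ≠ c → a ≠ d →
      ∫ ω, w a ω * (v b ω * w c ω * v d ω) ∂P = 0 := fun a b c d h1 h2 h3 =>
    hX.integral_entry_mul_eq_zero hQ (S := {s(b, L), s(c, L), s(d, L)})
      (by rw [hpos']; tauto)
      (measurable_entry_mul_mul (by simp [hpos]) (by simp [hpos']) (by simp [hpos]))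
  by_cases hij : i = j
  · subst hij
    by_cases hkl : k = l
    · subst hkl
      by_cases hik : i = k
      · subst hik
        -- When all indices agree both pairings count, and `E|X|⁴ = 2 ∫ x⁴ dQ + 1/2 = 1 + 1 + 2c`
        -- leaves the correction `2c`.
        rw [hX.integral_entry_mul_swap_sq hQ hi]
        simp only [and_self, if_true]
        push_cast
        ring
      · rw [hpair i k hi hk hik]
        simp [hik]
    · by_cases hik : i = k
      · subst hik
        simp only [hkl, and_false, false_and, if_false, add_zero]
        refine (integral_congr_ae (Eventually.of_forall fun ω => ?_)).trans
          (isoV l i i i (Ne.symm hkl) (Ne.symm hkl) (Ne.symm hkl))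
        ring
      · have h0 := isoW k i i l (Ne.symm hik) (Ne.symm hik) hkl
        simp only [hkl, hik, and_false, if_false, add_zero]
        refine (integral_congr_ae (Eventually.of_forall fun ω => ?_)).trans h0
        ring
  · by_cases hil : i = l
    · subst hil
      by_cases hjk : j = k
      · subst hjk
        simp only [hij, false_and, if_false, and_self, if_true, zero_add, add_zero]
        refine (integral_congr_ae (Eventually.of_forall fun ω => ?_)).trans
          (hpair i j hi hj hij)
        ring
      · have h0 := isoV j i k i (Ne.symm hij) hjk (Ne.symm hij)
        simp only [hij, hjk, and_false, false_and, if_false, add_zero]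
        refine (integral_congr_ae (Eventually.of_forall fun ω => ?_)).trans h0
        ring
    · simp only [hij, hil, false_and, if_false, add_zero]
      by_cases hik : i = k
      · subst hik
        by_cases hjl : j = l
        · subst hjl
          have h0 : ∫ ω, (w i ω * w i ω) * (v j ω * v j ω) ∂P = 0 := by
            rw [hX.integral_mul (A := {s(i, L)}) (B := {s(j, L)})
              (Set.disjoint_singleton.2 (by rwa [Ne, Sym2.congr_left]))
              (measurable_entry_mul ((mem i i).2 rfl) ((mem i i).2 rfl))
              (measurable_entry_mul ((mem' j j).2 rfl) ((mem' j j).2 rfl)),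
              hX.integral_entry_sq hQ hi.ne', zero_mul]
          refine (integral_congr_ae (Eventually.of_forall fun ω => ?_)).trans h0
          ring
        · have h0 := isoV j i i l (Ne.symm hij) (Ne.symm hij) hjl
          refine (integral_congr_ae (Eventually.of_forall fun ω => ?_)).trans h0
          ring
      · have h0 := isoW i j k l hij hik hil
        refine (integral_congr_ae (Eventually.of_forall fun ω => ?_)).trans h0
        ring

end Moments

/-! ### Averaging over the last row and column -/

section Recursion

open Polynomial

/-- The principal submatrix of the infinite Wigner matrix with indices `e 0, …, e (N - 1)`. -/
noncomputable def principalSubmatrix {Ω : Type*} (Xdiag : ℕ → Ω → ℝ) (Xre Xim : ℕ → ℕ → Ω → ℝ)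
    {N : ℕ} (e : Fin N → ℕ) (ω : Ω) : Matrix (Fin N) (Fin N) ℂ :=
  Matrix.of fun i j => entry Xdiag Xre Xim (e i) (e j) ω

/-- The unordered positions of the entries of a principal submatrix. -/
def positions {N : ℕ} (e : Fin N → ℕ) : Set (Sym2 ℕ) := {q | ∃ i j, q = s(e i, e j)}

variable {Ω : Type*} {Xdiag : ℕ → Ω → ℝ} {Xre Xim : ℕ → ℕ → Ω → ℝ} {N : ℕ}

theorem measurable_scalar_sub (e : Fin N → ℕ) (z : ℂ) (i j : Fin N) :
    Measurable[sigmaOf Xdiag Xre Xim (positions e)]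
      (fun ω => (Matrix.scalar (Fin N) z - principalSubmatrix Xdiag Xre Xim e ω) i j) :=
  (measurable_entry_sigmaOf (show s(e i, e j) ∈ positions e from ⟨i, j, rfl⟩)).const_sub _

theorem measurable_eval_charpoly (e : Fin N → ℕ) (z : ℂ) :
    Measurable[sigmaOf Xdiag Xre Xim (positions e)]
      (fun ω => (principalSubmatrix Xdiag Xre Xim e ω).charpoly.eval z) := by
  simp only [Matrix.eval_charpoly]
  exact @measurable_det Ω (sigmaOf Xdiag Xre Xim (positions e)) _ _ _ _
    (measurable_scalar_sub e z)

theorem measurable_updateRow (e : Fin N → ℕ) (z : ℂ) (i j k l : Fin N) :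
    Measurable[sigmaOf Xdiag Xre Xim (positions e)]
      (fun ω => ((Matrix.scalar (Fin N) z - principalSubmatrix Xdiag Xre Xim e ω).updateRow
        j (Pi.single i 1)) k l) := by
  by_cases h : k = j
  · subst h
    simp only [Matrix.updateRow_self]
    exact measurable_const
  · simp only [Matrix.updateRow_ne h]
    exact measurable_scalar_sub e z k l

theorem measurable_adjugate (e : Fin N → ℕ) (z : ℂ) (i j : Fin N) :
    Measurable[sigmaOf Xdiag Xre Xim (positions e)]
      (fun ω => (Matrix.scalar (Fin N) z - principalSubmatrix Xdiag Xre Xim e ω).adjugate i j) := by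
  simp only [Matrix.adjugate_apply]
  exact @measurable_det Ω (sigmaOf Xdiag Xre Xim (positions e)) _ _ _ _
    (measurable_updateRow e z i j)

theorem principalSubmatrix_castSucc (e : Fin (N + 1) → ℕ) (ω : Ω) :
    (principalSubmatrix Xdiag Xre Xim e ω).submatrix Fin.castSucc Fin.castSucc
      = principalSubmatrix Xdiag Xre Xim (e ∘ Fin.castSucc) ω := rfl

theorem norm_scalar_sub_le (e : Fin N → ℕ) (z : ℂ) (i j : Fin N) (ω : Ω) :
    ‖(Matrix.scalar (Fin N) z - principalSubmatrix Xdiag Xre Xim e ω) i j‖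
      ≤ ‖z‖ + ‖entry Xdiag Xre Xim (e i) (e j) ω‖ := by
  refine (norm_sub_le _ _).trans (add_le_add ?_ le_rfl)
  by_cases h : i = j <;> simp [h]

variable [mΩ : MeasurableSpace Ω] {P : Measure Ω} [IsProbabilityMeasure P] {Q : Measure ℝ}

theorem IsWignerFamily.memLp_eval_charpoly (hX : IsWignerFamily P Q Xdiag Xre Xim)
    (hQ : MomentConditions Q) {e : Fin N → ℕ} (he : Function.Injective e) (z : ℂ) :
    MemLp (fun ω => (principalSubmatrix Xdiag Xre Xim e ω).charpoly.eval z) 2 P := by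
  simp only [Matrix.eval_charpoly]
  exact hX.memLp_det hQ he
    (fun i j => (measurable_scalar_sub e z i j).mono (hX.sigmaOf_le _) le_rfl) ‖z‖
    (norm_scalar_sub_le e z)

theorem IsWignerFamily.memLp_adjugate (hX : IsWignerFamily P Q Xdiag Xre Xim)
    (hQ : MomentConditions Q) {e : Fin N → ℕ} (he : Function.Injective e) (z : ℂ)
    (i j : Fin N) :
    MemLp (fun ω => (Matrix.scalar (Fin N) z
      - principalSubmatrix Xdiag Xre Xim e ω).adjugate i j) 2 P := by
  simp only [Matrix.adjugate_apply]
  refine hX.memLp_det hQ he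
    (fun k l => (measurable_updateRow e z i j k l).mono (hX.sigmaOf_le _) le_rfl) (‖z‖ + 1)
    (fun k l ω => ?_)
  by_cases h : k = j
  · subst h
    rw [Matrix.updateRow_self]
    have h1 : ‖(Pi.single i 1 : Fin N → ℂ) l‖ ≤ 1 := by
      by_cases h : l = i
      · subst h; simp
      · simp [h]
    have := norm_nonneg z
    have := norm_nonneg (entry Xdiag Xre Xim (e k) (e l) ω)
    linarith
  · rw [Matrix.updateRow_ne h]
    have := norm_scalar_sub_le (Xdiag := Xdiag) (Xre := Xre) (Xim := Xim) e z k l ω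
    linarith

theorem sum_pairing {N : ℕ} (G : Fin N × Fin N → Fin N × Fin N → ℂ) (κ : ℂ) :
    ∑ p : Fin N × Fin N, ∑ q : Fin N × Fin N,
      ((if p.1 = p.2 ∧ q.1 = q.2 then 1 else 0) + (if p.1 = q.2 ∧ p.2 = q.1 then 1 else 0)
        + (if p.1 = p.2 ∧ p.2 = q.1 ∧ q.1 = q.2 then κ else 0)) * G p q
      = ∑ i, ∑ k, G (i, i) (k, k) + ∑ i, ∑ j, G (i, j) (j, i)
        + κ * ∑ i, G (i, i) (i, i) := by
  simp only [add_mul, Finset.sum_add_distrib, Fintype.sum_prod_type, ite_and, ite_mul, one_mul,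
    zero_mul, Finset.sum_ite_irrel, Finset.sum_const_zero, Finset.sum_ite_eq,
    Finset.mem_univ, if_true, Finset.mul_sum]

theorem sum_diagonal {N : ℕ} (G : Fin N × Fin N → ℂ) (c : ℂ) :
    ∑ p : Fin N × Fin N, (c * if p.1 = p.2 then 1 else 0) * G p = c * ∑ i, G (i, i) := by
  simp [Fintype.sum_prod_type, Finset.mul_sum]

/-- The recursion for the second moments of characteristic polynomials obtained by averaging
over the last row and column. -/
theorem IsWignerFamily.integral_charpoly_succ (hX : IsWignerFamily P Q Xdiag Xre Xim)
    (hQ : MomentConditions Q) {e : Fin (N + 1) → ℕ} (he : StrictMono e) (z w : ℂ) :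
    let M := principalSubmatrix Xdiag Xre Xim (e ∘ Fin.castSucc)
    let A := fun ω => (Matrix.scalar (Fin N) z - M ω).adjugate
    let B := fun ω => (Matrix.scalar (Fin N) w - M ω).adjugate
    ∫ ω, (principalSubmatrix Xdiag Xre Xim e ω).charpoly.eval z
        * (principalSubmatrix Xdiag Xre Xim e ω).charpoly.eval w ∂P
      = (1 + z * w) * ∫ ω, (M ω).charpoly.eval z * (M ω).charpoly.eval w ∂P
        - z * ∫ ω, (M ω).charpoly.eval z * (derivative (M ω).charpoly).eval w ∂P
        - w * ∫ ω, (derivative (M ω).charpoly).eval z * (M ω).charpoly.eval w ∂P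
        + ∫ ω, (derivative (M ω).charpoly).eval z * (derivative (M ω).charpoly).eval w ∂P
        + ∫ ω, ∑ i, ∑ j, A ω i j * B ω j i ∂P
        + 2 * (((∫ x, x ^ 4 ∂Q) - 3 / 4 : ℝ) : ℂ) * ∑ i, ∫ ω, A ω i i * B ω i i ∂P := by
  intro M A B
  set κ : ℂ := 2 * (((∫ x, x ^ 4 ∂Q) - 3 / 4 : ℝ) : ℂ) with hκ
  set L := e (Fin.last N) with hL
  have he' : Function.Injective (e ∘ Fin.castSucc) :=
    he.injective.comp (Fin.castSucc_injective N)
  have hlt : ∀ i : Fin N, e (Fin.castSucc i) < L := fun i => he (Fin.castSucc_lt_last i)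
  set S : Set (Sym2 ℕ) := positions (e ∘ Fin.castSucc) with hS
  set T : Set (Sym2 ℕ) := {q | L ∈ q} with hT
  -- The last index exceeds all the others, so no border position lies in the submatrix: the border
  -- is independent of `M`.
  have hTS : Disjoint T S := by
    rw [Set.disjoint_left]
    rintro q hq ⟨i, j, rfl⟩
    rcases Sym2.mem_iff.1 hq with h | h
    · exact (hlt i).ne' h
    · exact (hlt j).ne' h
  have memT1 : ∀ a, s(L, a) ∈ T := fun a => Sym2.mem_mk_left _ _
  have memT2 : ∀ a, s(a, L) ∈ T := fun a => Sym2.mem_mk_right _ _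
  set x : Ω → ℂ := entry Xdiag Xre Xim L L with hx
  set t : Fin N × Fin N → Ω → ℂ := fun p ω =>
    entry Xdiag Xre Xim L (e (Fin.castSucc p.1)) ω
      * entry Xdiag Xre Xim (e (Fin.castSucc p.2)) L ω with ht
  set a : Fin N × Fin N → Ω → ℂ := fun p ω => A ω p.1 p.2 with ha
  set b : Fin N × Fin N → Ω → ℂ := fun p ω => B ω p.1 p.2 with hb
  set F : Ω → ℂ := fun ω => (M ω).charpoly.eval z with hF
  set G : Ω → ℂ := fun ω => (M ω).charpoly.eval w with hG
  -- measurability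
  have mx : Measurable[sigmaOf Xdiag Xre Xim T] x := measurable_entry_sigmaOf (memT1 L)
  have mxc : ∀ c : ℂ, Measurable[sigmaOf Xdiag Xre Xim T] (fun ω => c - x ω) :=
    fun c => mx.const_sub c
  have mt : ∀ p, Measurable[sigmaOf Xdiag Xre Xim T] (t p) := fun p =>
    measurable_entry_mul (memT1 _) (memT2 _)
  have ma : ∀ p, Measurable[sigmaOf Xdiag Xre Xim S] (a p) := fun p =>
    measurable_adjugate _ _ _ _
  have mb : ∀ p, Measurable[sigmaOf Xdiag Xre Xim S] (b p) := fun p =>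
    measurable_adjugate _ _ _ _
  have mF : Measurable[sigmaOf Xdiag Xre Xim S] F := measurable_eval_charpoly _ _
  have mG : Measurable[sigmaOf Xdiag Xre Xim S] G := measurable_eval_charpoly _ _
  -- square integrability
  have Lx : MemLp x 2 P := hX.memLp_two_entry hQ L L
  have Lxc : ∀ c : ℂ, MemLp (fun ω => c - x ω) 2 P := fun c => (memLp_const c).sub Lx
  have Lt : ∀ p, MemLp (t p) 2 P := fun p => (hX.memLp_entry hQ _ _).mul (hX.memLp_entry hQ _ _)
  have La : ∀ p, MemLp (a p) 2 P := fun p => hX.memLp_adjugate hQ he' z _ _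
  have Lb : ∀ p, MemLp (b p) 2 P := fun p => hX.memLp_adjugate hQ he' w _ _
  have LF : MemLp F 2 P := hX.memLp_eval_charpoly hQ he' z
  have LG : MemLp G 2 P := hX.memLp_eval_charpoly hQ he' w
  have prod_int : ∀ f g : Ω → ℂ, MemLp f 2 P → MemLp g 2 P →
      Integrable (fun ω => f ω * g ω) P := fun f g hf hg => hf.integrable_mul hg
  have key : ∀ f g f' g' : Ω → ℂ, MemLp f 2 P → MemLp g 2 P → MemLp f' 2 P → MemLp g' 2 P →
      Measurable[sigmaOf Xdiag Xre Xim T] f → Measurable[sigmaOf Xdiag Xre Xim T] g →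
      Measurable[sigmaOf Xdiag Xre Xim S] f' → Measurable[sigmaOf Xdiag Xre Xim S] g' →
      Integrable (fun ω => (f ω * g ω) * (f' ω * g' ω)) P ∧
      ∫ ω, (f ω * g ω) * (f' ω * g' ω) ∂P
        = (∫ ω, f ω * g ω ∂P) * ∫ ω, f' ω * g' ω ∂P := by
    intro f g f' g' h1 h2 h3 h4 m1 m2 m3 m4
    exact ⟨hX.integrable_mul hTS (m1.mul m2) (m3.mul m4) (prod_int f g h1 h2)
      (prod_int f' g' h3 h4), hX.integral_mul hTS (m1.mul m2) (m3.mul m4)⟩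
  -- moments of the last row and column
  have ex : ∫ ω, (z - x ω) * (w - x ω) ∂P = 1 + z * w := by
    have h1 : ∀ ω, (z - x ω) * (w - x ω) = z * w - (z + w) * x ω + x ω * x ω := fun ω => by ring
    have i1 : Integrable x P := Lx.integrable one_le_two
    have i2 : Integrable (fun ω => z * w - (z + w) * x ω) P :=
      (integrable_const _).sub (i1.const_mul _)
    simp only [h1]
    rw [integral_add i2 (prod_int x x Lx Lx), integral_sub (integrable_const _) (i1.const_mul _),
      integral_const_mul (z + w), hX.integral_entry hQ, hX.integral_entry_self_sq hQ]
    simp [add_comm]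
  have et : ∀ p, ∫ ω, t p ω ∂P = if p.1 = p.2 then 1 else 0 := fun p => by
    rw [hX.integral_row_mul_col hQ (hlt p.1)]
    simp only [he.injective.eq_iff, Fin.castSucc_inj]
  -- Both factors live on the border, so a finer splitting is used: the corner entry against the
  -- rest of the border.
  have ext : ∀ c p, ∫ ω, (c - x ω) * t p ω ∂P = c * if p.1 = p.2 then 1 else 0 := by
    intro c p
    rw [hX.integral_mul (A := {s(L, L)}) (B := {q | ∃ i : Fin N, q = s(e (Fin.castSucc i), L)})
      ?_ ((measurable_entry_sigmaOf (Set.mem_singleton _)).const_sub c)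
      (measurable_entry_mul ⟨p.1, Sym2.eq_swap⟩ ⟨p.2, rfl⟩), et,
      integral_sub (integrable_const _) (Lx.integrable one_le_two), hX.integral_entry hQ]
    · simp
    · rw [Set.disjoint_singleton_left]
      rintro ⟨i, hi⟩
      rw [Sym2.congr_left] at hi
      exact (hlt i).ne' hi
  have ett : ∀ p q, ∫ ω, t p ω * t q ω ∂P
      = (if p.1 = p.2 ∧ q.1 = q.2 then 1 else 0) + (if p.1 = q.2 ∧ p.2 = q.1 then 1 else 0)
        + (if p.1 = p.2 ∧ p.2 = q.1 ∧ q.1 = q.2 then κ else 0) := fun p q => by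
    rw [hX.integral_row_mul_col_mul_row_mul_col hQ (hlt _) (hlt _) (hlt _)]
    simp only [he.injective.eq_iff, Fin.castSucc_inj, hκ]
  -- expansion
  have expand : ∀ (y : ℂ) ω, (principalSubmatrix Xdiag Xre Xim e ω).charpoly.eval y
      = (y - x ω) * (M ω).charpoly.eval y
        - ∑ p, t p ω * (Matrix.scalar (Fin N) y - M ω).adjugate p.1 p.2 := by
    intro y ω
    rw [eval_charpoly_succ, principalSubmatrix_castSucc, Fintype.sum_prod_type]
    congr 1
    refine Finset.sum_congr rfl fun i _ => Finset.sum_congr rfl fun j _ => ?_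
    exact mul_right_comm _ _ _
  -- Every summand is grouped as a border factor times a factor depending on `M`, the form to which
  -- `key` applies.
  have expand2 : ∀ ω, (principalSubmatrix Xdiag Xre Xim e ω).charpoly.eval z
      * (principalSubmatrix Xdiag Xre Xim e ω).charpoly.eval w
      = ((z - x ω) * (w - x ω)) * (F ω * G ω)
        - ∑ q, ((z - x ω) * t q ω) * (F ω * b q ω)
        - ∑ p, ((w - x ω) * t p ω) * (a p ω * G ω)
        + ∑ p, ∑ q, (t p ω * t q ω) * (a p ω * b q ω) := by
    intro ω
    rw [expand z, expand w]
    have e1 : ∑ q, ((z - x ω) * t q ω) * (F ω * b q ω)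
        = ((z - x ω) * F ω) * ∑ q, t q ω * b q ω := by
      rw [Finset.mul_sum]; exact Finset.sum_congr rfl fun q _ => by ring
    have e2 : ∑ p, ((w - x ω) * t p ω) * (a p ω * G ω)
        = ((w - x ω) * G ω) * ∑ p, t p ω * a p ω := by
      rw [Finset.mul_sum]; exact Finset.sum_congr rfl fun q _ => by ring
    have e3 : ∑ p, ∑ q, (t p ω * t q ω) * (a p ω * b q ω)
        = (∑ p, t p ω * a p ω) * ∑ q, t q ω * b q ω := by
      rw [Finset.sum_mul_sum]
      exact Finset.sum_congr rfl fun p _ => Finset.sum_congr rfl fun q _ => by ring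
    rw [e1, e2, e3]
    ring
  have k1 := key _ _ _ _ (Lxc z) (Lxc w) LF LG (mxc z) (mxc w) mF mG
  have k2 := fun q => key _ _ _ _ (Lxc z) (Lt q) LF (Lb q) (mxc z) (mt q) mF (mb q)
  have k3 := fun p => key _ _ _ _ (Lxc w) (Lt p) (La p) LG (mxc w) (mt p) (ma p) mG
  have k4 := fun p q => key _ _ _ _ (Lt p) (Lt q) (La p) (Lb q) (mt p) (mt q) (ma p) (mb q)
  have i2 := integrable_finsetSum Finset.univ fun q _ => (k2 q).1
  have i3 := integrable_finsetSum Finset.univ fun p _ => (k3 p).1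
  have i4 := integrable_finsetSum Finset.univ fun p _ =>
    integrable_finsetSum Finset.univ fun q _ => (k4 p q).1
  have i12 := k1.1.sub i2
  have i123 := i12.sub i3
  have hF' : ∀ ω, (derivative (M ω).charpoly).eval z = ∑ i, a (i, i) ω := fun ω =>
    eval_derivative_charpoly _ _
  have hG' : ∀ ω, (derivative (M ω).charpoly).eval w = ∑ i, b (i, i) ω := fun ω =>
    eval_derivative_charpoly _ _
  simp only [expand2]
  refine (integral_add i123 i4).trans ?_
  refine (congrArg₂ (· + ·) ((integral_sub i12 i3).trans
    (congrArg₂ (· - ·) (integral_sub k1.1 i2) rfl)) rfl).trans ?_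
  simp only [hF', hG']
  rw [integral_finsetSum _ fun q _ => (k2 q).1, integral_finsetSum _ fun p _ => (k3 p).1,
    integral_finsetSum _ fun p _ => integrable_finsetSum Finset.univ fun q _ => (k4 p q).1]
  simp only [integral_finsetSum _ fun q _ => (k4 _ q).1, k1.2, (k2 _).2, (k3 _).2, (k4 _ _).2,
    ex, ext, ett, sum_pairing, sum_diagonal]
  have j1 : ∫ ω, F ω * ∑ i, b (i, i) ω ∂P = ∑ i, ∫ ω, F ω * b (i, i) ω ∂P := by
    simp only [Finset.mul_sum]
    exact integral_finsetSum _ fun i _ => prod_int _ _ LF (Lb _)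
  have j2 : ∫ ω, (∑ i, a (i, i) ω) * G ω ∂P = ∑ i, ∫ ω, a (i, i) ω * G ω ∂P := by
    simp only [Finset.sum_mul]
    exact integral_finsetSum _ fun i _ => prod_int _ _ (La _) LG
  have j3 : ∫ ω, (∑ i, a (i, i) ω) * ∑ k, b (k, k) ω ∂P
      = ∑ i, ∑ k, ∫ ω, a (i, i) ω * b (k, k) ω ∂P := by
    simp only [Finset.sum_mul_sum]
    rw [integral_finsetSum _ fun i _ => integrable_finsetSum _ fun k _ =>
      prod_int _ _ (La _) (Lb _)]
    exact Finset.sum_congr rfl fun i _ => integral_finsetSum _ fun k _ =>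
      prod_int _ _ (La _) (Lb _)
  have j4 : ∫ ω, ∑ i, ∑ j, A ω i j * B ω j i ∂P
      = ∑ i, ∑ j, ∫ ω, a (i, j) ω * b (j, i) ω ∂P := by
    rw [integral_finsetSum _ fun i _ => integrable_finsetSum _ fun k _ =>
      prod_int _ _ (La (i, k)) (Lb (k, i))]
    exact Finset.sum_congr rfl fun i _ => integral_finsetSum _ fun k _ =>
      prod_int _ _ (La (i, k)) (Lb (k, i))
  rw [j1, j2, j3, j4]
  ring

end Recursion

/-! ### Closed form of the second moments, and conclusion -/

section SecondMoments

open Polynomial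

theorem kern_sum_mul_left {𝕜 ι : Type*} [Field 𝕜] (M : ℕ) (s : Finset ι) (a : ι → ℕ → 𝕜)
    (α : ι → 𝕜) (b : ℕ → 𝕜) :
    kern M (fun n => ∑ k ∈ s, a k n * α k) b = ∑ k ∈ s, α k * kern M (a k) b := by
  simp only [kern, Finset.mul_sum, Finset.sum_mul, Finset.sum_div]
  rw [Finset.sum_comm]
  exact Finset.sum_congr rfl fun k _ => Finset.sum_congr rfl fun n _ => by ring

theorem momentForm_sum_mul_left {𝕜 ι : Type*} [Field 𝕜] (c : 𝕜) (N : ℕ) (s : Finset ι)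
    (a : ι → ℕ → 𝕜) (α : ι → 𝕜) (b : ℕ → 𝕜) :
    momentForm c N (fun n => ∑ k ∈ s, a k n * α k) b = ∑ k ∈ s, α k * momentForm c N (a k) b := by
  simp only [momentForm, kern_sum_mul_left, Finset.mul_sum]
  rw [Finset.sum_comm]
  exact Finset.sum_congr rfl fun k _ => Finset.sum_congr rfl fun n _ => by ring

theorem momentForm_comm {𝕜 : Type*} [Field 𝕜] (c : 𝕜) (N : ℕ) (a b : ℕ → 𝕜) :
    momentForm c N a b = momentForm c N b a := by
  simp only [momentForm, kern_comm _ a b]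

theorem momentForm_congr_left {𝕜 : Type*} [Field 𝕜] (c : 𝕜) (N : ℕ) {a a' : ℕ → 𝕜} (b : ℕ → 𝕜)
    (h : ∀ n ≤ N, a n = a' n) : momentForm c N a b = momentForm c N a' b := by
  simp only [momentForm, kern]
  congr 1
  refine Finset.sum_congr rfl fun k _ => ?_
  congr 1
  refine Finset.sum_congr rfl fun n hn => ?_
  rw [h n (by have := Finset.mem_range.1 hn; omega)]

/-- A linear functional on polynomials of degree at most `N` is a combination of `N + 1` point
evaluations. -/
theorem linear_eq_sum_eval {K : Type*} [Field K] (N : ℕ) {v : ℕ → K} (hv : Function.Injective v)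
    (l : K[X] →ₗ[K] K) {p : K[X]} (hp : p.natDegree ≤ N) :
    l p = ∑ k ∈ Finset.range (N + 1),
      p.eval (v k) * l (Lagrange.basis (Finset.range (N + 1)) v k) := by
  have h := Lagrange.eq_interpolate (s := Finset.range (N + 1)) (v := v) (f := p)
    (hv.injOn) (by
      rw [Finset.card_range]
      exact degree_le_natDegree.trans_lt (by exact_mod_cast Nat.lt_succ_of_le hp))
  conv_lhs => rw [h, Lagrange.interpolate_apply, map_sum]
  refine Finset.sum_congr rfl fun k _ => ?_
  rw [C_mul', map_smul, smul_eq_mul]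

theorem D_eq_charpoly {Ω : Type*} {Xdiag : ℕ → Ω → ℝ} {Xre Xim : ℕ → ℕ → Ω → ℝ} (N : ℕ) (ξ η : ℝ) (ω : Ω) :
    (D Xdiag Xre Xim N ξ η ω : ℂ) = (-1) ^ N *
      (principalSubmatrix Xdiag Xre Xim (Fin.val : Fin N → ℕ) ω).charpoly.eval
        (point N ξ η : ℂ) := by
  rw [coe_D, Matrix.eval_charpoly, ← neg_sub, Matrix.det_neg, Fintype.card_fin]
  congr 3
  ext i j
  by_cases hij : i = j <;> simp [hij]

variable {Ω : Type*} [MeasurableSpace Ω] {P : Measure Ω}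

/-- If the second moments of the values of a random polynomial at distinct points are given by
`momentForm`, so are those of all pairs of linear functionals. -/
theorem integral_linear_mul_linear {N : ℕ} {p : Ω → ℂ[X]} (hp : ∀ ω, (p ω).natDegree ≤ N)
    (hL : ∀ z, MemLp (fun ω => (p ω).eval z) 2 P) (c : ℂ)
    (h : ∀ z w : ℂ, z ≠ w → ∫ ω, (p ω).eval z * (p ω).eval w ∂P
      = momentForm c N (hermEval z) (hermEval w)) (l m : ℂ[X] →ₗ[ℂ] ℂ) :
    ∫ ω, l (p ω) * m (p ω) ∂P
      = momentForm c N (fun n => l (herm ℂ n)) (fun n => m (herm ℂ n)) := by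
  set v : ℕ → ℂ := fun k => (k : ℂ) with hv
  -- The nodes for `m` are kept disjoint from the nodes `0, …, N` for `l`, because the moments are
  -- only given at distinct points.
  set u : ℕ → ℂ := fun k => ((k + (N + 1) : ℕ) : ℂ) with hu
  have hvi : Function.Injective v := Nat.cast_injective
  have hui : Function.Injective u := fun a b hab => by
    have := Nat.cast_injective (R := ℂ) hab
    omega
  have hne : ∀ k ∈ Finset.range (N + 1), ∀ j, v k ≠ u j := fun k hk j hkj => by
    have := Nat.cast_injective (R := ℂ) hkj
    have := Finset.mem_range.1 hk
    omega
  set α : ℕ → ℂ := fun k => l (Lagrange.basis (Finset.range (N + 1)) v k) with hα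
  set β : ℕ → ℂ := fun k => m (Lagrange.basis (Finset.range (N + 1)) u k) with hβ
  have hl : ∀ n ≤ N, l (herm ℂ n) = ∑ k ∈ Finset.range (N + 1), hermEval (v k) n * α k :=
    fun n hn => linear_eq_sum_eval N hvi l ((natDegree_herm_le n).trans hn)
  have hm : ∀ n ≤ N, m (herm ℂ n) = ∑ k ∈ Finset.range (N + 1), hermEval (u k) n * β k :=
    fun n hn => linear_eq_sum_eval N hui m ((natDegree_herm_le n).trans hn)
  rw [momentForm_congr_left c N _ hl, momentForm_comm, momentForm_congr_left c N _ hm,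
    momentForm_sum_mul_left]
  have e : ∀ ω, l (p ω) * m (p ω) = ∑ j ∈ Finset.range (N + 1), ∑ k ∈ Finset.range (N + 1),
      (β j * α k) * ((p ω).eval (v k) * (p ω).eval (u j)) := fun ω => by
    rw [linear_eq_sum_eval N hvi l (hp ω), linear_eq_sum_eval N hui m (hp ω), mul_comm,
      Finset.sum_mul_sum]
    exact Finset.sum_congr rfl fun j _ => Finset.sum_congr rfl fun k _ => by ring
  have hi : ∀ j k, Integrable (fun ω => (β j * α k) * ((p ω).eval (v k) * (p ω).eval (u j))) P :=
    fun j k => ((hL _).integrable_mul (hL _)).const_mul _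
  simp only [e]
  rw [integral_finsetSum _ fun j _ => integrable_finsetSum _ fun k _ => hi j k]
  refine Finset.sum_congr rfl fun j _ => ?_
  rw [integral_finsetSum _ fun k _ => hi j k, momentForm_comm, momentForm_sum_mul_left,
    Finset.mul_sum]
  refine Finset.sum_congr rfl fun k hk => ?_
  rw [integral_const_mul, h _ _ (hne k hk j), mul_assoc]

variable {Xdiag : ℕ → Ω → ℝ} {Xre Xim : ℕ → ℕ → Ω → ℝ} [IsProbabilityMeasure P] {Q : Measure ℝ}

theorem IsWignerFamily.integral_charpoly_mul (hX : IsWignerFamily P Q Xdiag Xre Xim)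
    (hQ : MomentConditions Q) (N : ℕ) {e : Fin N → ℕ} (he : StrictMono e)
    (l m : ℂ[X] →ₗ[ℂ] ℂ) :
    ∫ ω, l (principalSubmatrix Xdiag Xre Xim e ω).charpoly
        * m (principalSubmatrix Xdiag Xre Xim e ω).charpoly ∂P
      = momentForm (((∫ x, x ^ 4 ∂Q) - 3 / 4 : ℝ) : ℂ) N
        (fun n => l (herm ℂ n)) (fun n => m (herm ℂ n)) := by
  -- The step to `N + 1` uses sizes `N` and `N - 1`. The index map `e`, whose type depends on `N`,
  -- varies along with it, and so do the functionals.
  induction N using Nat.strong_induction_on generalizing l m with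
  | _ N ih =>
  refine integral_linear_mul_linear (fun ω => ?_)
    (fun z => hX.memLp_eval_charpoly hQ he.injective z) _ (fun z w hzw => ?_) l m
  · rw [Matrix.charpoly_natDegree_eq_dim, Fintype.card_fin]
  rcases N with _ | N
  · simp [momentForm_zero, hermEval_zero, Matrix.charpoly]
  set c : ℂ := (((∫ x, x ^ 4 ∂Q) - 3 / 4 : ℝ) : ℂ) with hc
  have he' : StrictMono (e ∘ Fin.castSucc) := he.comp Fin.strictMono_castSucc
  have ihN := ih N (Nat.lt_succ_self N) he'
  set M := principalSubmatrix Xdiag Xre Xim (e ∘ Fin.castSucc) with hM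
  have h00 : ∫ ω, (M ω).charpoly.eval z * (M ω).charpoly.eval w ∂P
      = momentForm c N (hermEval z) (hermEval w) := ihN (leval z) (leval w)
  have h01 : ∀ z w, ∫ ω, (M ω).charpoly.eval z * (derivative (M ω).charpoly).eval w ∂P
      = momentForm c N (hermEval z) (hermDeriv w) := fun z w =>
    ihN (leval z) ((leval w).comp derivative)
  have h10 : ∀ z w, ∫ ω, (derivative (M ω).charpoly).eval z * (M ω).charpoly.eval w ∂P
      = momentForm c N (hermDeriv z) (hermEval w) := fun z w =>
    ihN ((leval z).comp derivative) (leval w)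
  have h11 : ∫ ω, (derivative (M ω).charpoly).eval z * (derivative (M ω).charpoly).eval w ∂P
      = momentForm c N (hermDeriv z) (hermDeriv w) :=
    ihN ((leval z).comp derivative) ((leval w).comp derivative)
  have hLp : ∀ z, MemLp (fun ω => (M ω).charpoly.eval z) 2 P :=
    hX.memLp_eval_charpoly hQ he'.injective
  have hLd : ∀ z, MemLp (fun ω => (derivative (M ω).charpoly).eval z) 2 P := fun z => by
    simp only [eval_derivative_charpoly]
    exact memLp_finsetSum _ fun i _ => hX.memLp_adjugate hQ he'.injective z i i
  have hT : (z - w) * ∫ ω, ∑ i, ∑ j, (Matrix.scalar (Fin N) z - M ω).adjugate i j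
        * (Matrix.scalar (Fin N) w - M ω).adjugate j i ∂P
      = momentForm c N (hermEval z) (hermDeriv w) - momentForm c N (hermDeriv z) (hermEval w) := by
    rw [← integral_const_mul, ← h01, ← h10]
    refine Eq.trans (integral_congr_ae (Eventually.of_forall fun ω => ?_))
      (integral_sub ((hLp z).integrable_mul (hLd w)) ((hLd z).integrable_mul (hLp w)))
    simp only [sub_mul_sum_adjugate_mul_adjugate]
    ring
  -- A diagonal entry of the adjugate is the characteristic polynomial of `M` with row and column
  -- `i` deleted, again a principal submatrix with increasing indices. By the induction hypothesis
  -- its moment does not depend on `i`. For `N = 0` both sides vanish, so the truncated `N - 1` is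
  -- harmless.
  have hdiag : ∑ i, ∫ ω, (Matrix.scalar (Fin N) z - M ω).adjugate i i
        * (Matrix.scalar (Fin N) w - M ω).adjugate i i ∂P
      = N * momentForm c (N - 1) (hermEval z) (hermEval w) := by
    rcases N with _ | N
    · simp
    · have hmin : ∀ (i : Fin (N + 1)) (y : ℂ) ω,
          (Matrix.scalar (Fin (N + 1)) y - M ω).adjugate i i
          = (principalSubmatrix Xdiag Xre Xim (e ∘ Fin.castSucc ∘ i.succAbove) ω).charpoly.eval y := by
        intro i y ω
        rw [Matrix.adjugate_fin_succ_eq_det_submatrix, Matrix.eval_charpoly, ← two_mul, pow_mul,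
          neg_one_sq, one_pow, one_mul]
        congr 1
        ext a b
        by_cases hab : a = b
        · subst hab
          simp [hM, principalSubmatrix]
        · simp [hM, principalSubmatrix, hab]
      have heach : ∀ i : Fin (N + 1), ∫ ω, (Matrix.scalar (Fin (N + 1)) z - M ω).adjugate i i
          * (Matrix.scalar (Fin (N + 1)) w - M ω).adjugate i i ∂P
          = momentForm c N (hermEval z) (hermEval w) := by
        intro i
        simp only [hmin]
        exact ih N (by omega) (he.comp (Fin.strictMono_castSucc.comp (Fin.strictMono_succAbove i)))
          (leval z) (leval w)
      rw [Finset.sum_congr rfl fun i _ => heach i]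
      simp
  have hrec := hX.integral_charpoly_succ hQ he z w
  simp only at hrec
  rw [← hM, h00, h01, h10, h11, hdiag] at hrec
  rw [hrec, ← momentForm_recursion c hzw N hT]
  ring

theorem ofReal_hermEval (x : ℝ) (n : ℕ) : ((hermEval x n : ℝ) : ℂ) = hermEval (x : ℂ) n := by
  simp only [hermEval, herm, eval_map]
  exact (hom_eval₂ _ _ Complex.ofRealHom _).trans (by congr 1)

theorem ofReal_momentForm (c : ℝ) (N : ℕ) (x y : ℝ) :
    ((momentForm c N (hermEval x) (hermEval y) : ℝ) : ℂ)
      = momentForm (c : ℂ) N (hermEval (x : ℂ)) (hermEval (y : ℂ)) := by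
  simp [momentForm, kern, ofReal_hermEval]

theorem IsWignerFamily.memLp_D (hX : IsWignerFamily P Q Xdiag Xre Xim)
    (hQ : MomentConditions Q) (N : ℕ) (ξ η : ℝ) : MemLp (D Xdiag Xre Xim N ξ η) 2 P := by
  have h := ((hX.memLp_eval_charpoly hQ (Fin.val_injective (n := N))
    (point N ξ η : ℂ)).const_mul ((-1) ^ N)).re
  refine h.ae_eq (Eventually.of_forall fun ω => ?_)
  rw [← D_eq_charpoly]
  exact Complex.ofReal_re _

theorem IsWignerFamily.integral_D_mul_D (hX : IsWignerFamily P Q Xdiag Xre Xim)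
    (hQ : MomentConditions Q) (N : ℕ) (ξ η θ : ℝ) :
    ∫ ω, D Xdiag Xre Xim N ξ η ω * D Xdiag Xre Xim N ξ θ ω ∂P
      = momentForm ((∫ x, x ^ 4 ∂Q) - 3 / 4) N (hermEval (point N ξ η))
        (hermEval (point N ξ θ)) := by
  apply Complex.ofReal_injective
  rw [ofReal_momentForm, ← integral_complex_ofReal]
  refine Eq.trans (integral_congr_ae (Eventually.of_forall fun ω => ?_))
    (hX.integral_charpoly_mul hQ N (e := (Fin.val : Fin N → ℕ)) (fun _ _ h => h)
      (leval (point N ξ η : ℂ)) (leval (point N ξ θ : ℂ)))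
  simp only [Complex.ofReal_mul, D_eq_charpoly, leval_apply]
  rw [mul_mul_mul_comm, ← mul_pow]
  simp

end SecondMoments

end Wigner

theorem corollary1
    (Q : Measure ℝ) [IsProbabilityMeasure Q] (hQ : Wigner.MomentConditions Q)
    {Ω : Type*} [MeasurableSpace Ω] (P : Measure Ω) [IsProbabilityMeasure P]
    (Xdiag : ℕ → Ω → ℝ) (Xre Xim : ℕ → ℕ → Ω → ℝ)
    (hX : Wigner.IsWignerFamily P Q Xdiag Xre Xim)
    (ξ : ℝ) (hξ : ξ ∈ Set.Ioo (-2 : ℝ) 2) (μ ν : ℝ) :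
    -- all expectations below exist, and the denominators are eventually nonzero
    (∀ N, MemLp (Wigner.D Xdiag Xre Xim N ξ μ) 2 P) ∧
    (∀ N, MemLp (Wigner.D Xdiag Xre Xim N ξ ν) 2 P) ∧
    (∀ᶠ N in atTop, 0 < ∫ ω, Wigner.D Xdiag Xre Xim N ξ μ ω ^ 2 ∂P) ∧
    (∀ᶠ N in atTop, 0 < ∫ ω, Wigner.D Xdiag Xre Xim N ξ ν ω ^ 2 ∂P) ∧
    Tendsto
      (fun N : ℕ =>
        (∫ ω, Wigner.D Xdiag Xre Xim N ξ μ ω * Wigner.D Xdiag Xre Xim N ξ ν ω ∂P) /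
          (√(∫ ω, Wigner.D Xdiag Xre Xim N ξ μ ω ^ 2 ∂P) *
            √(∫ ω, Wigner.D Xdiag Xre Xim N ξ ν ω ^ 2 ∂P)))
      atTop (𝓝 (Real.sinc (Real.pi * (μ - ν)))) := by
  refine ⟨fun N => hX.memLp_D hQ N ξ μ, fun N => hX.memLp_D hQ N ξ ν, ?_⟩
  simp only [sq, hX.integral_D_mul_D hQ]
  exact ⟨Wigner.momentForm_self_pos hξ _ μ, Wigner.momentForm_self_pos hξ _ ν,
    Wigner.tendsto_momentForm_ratio hξ _ μ ν⟩
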